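/- Let $\Gamma\subset S^2\subset\mathbf R^3$ be a $\mathcal C^2$-regular simple closed curve, i.e. the image of an injective $\mathcal C^2$ map $\gamma\colon S^1\simeq\mathbf R/2\pi\to S^2$ with nowhere vanishing derivative, and let $k=\langle\gamma'',\gamma\times\gamma'\rangle/\|\gamma'\|^3\colon S^1\to\mathbf R$ be its geodesic curvature. Suppose that $\Gamma$ is circumscribed in a great circle $C$, meaning that $\Gamma$ lies in one of the two closed hemispheres bounded by $C$, and that $\Gamma$ has no geodesic subarcs, i.e. $k$ does not vanish identically on any nondegenerate subarc. Suppose further that $\Gamma\cap C$ includes $n$ distinct points which are not all contained in one open semicircle of $C$. Then $k$ changes sign at least $2n$ times: there are $2n$ cyclically ordered points of $S^1$ at which $k\neq 0$ and such that $k$ has opposite signs at each two cyclically consecutive ones. In particular, if $\Gamma$ has only finitely many inflections (points where $k=0$), then at least $2n$ of them are genuine, where an inflection is genuine if it has a connected open neighborhood in $\Gamma$ in which $k$ vanishes just once and changes sign. -/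

import Mathlib

noncomputable section

namespace SphericalCurve

open Set

/-- Euclidean `3`-space. -/
abbrev E3 : Type := EuclideanSpace ℝ (Fin 3)

/-- The circle `S¹ = ℝ / 2πℤ`, the parameter space of closed curves. -/
abbrev S1 : Type := AddCircle (2 * Real.pi)

/-- The unit sphere `S² ⊂ ℝ³`. -/
def S2 : Set E3 := Metric.sphere (0 : E3) 1

/-- The derivative of a map on the circle with respect to the angular parameter. -/
def circleDeriv (γ : S1 → E3) (x : S1) : E3 :=
  deriv (fun s : ℝ => γ (x + (s : S1))) 0

/-- The vector product of `ℝ³`. -/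
def cross (u v : E3) : E3 :=
  WithLp.toLp 2 (crossProduct (WithLp.ofLp u) (WithLp.ofLp v))

/-- `γ : S¹ → S²` is a regular `C²` parametrization of a simple closed curve of the sphere. -/
structure IsC2RegularSimpleClosed (γ : S1 → E3) : Prop where
  mem_sphere : ∀ x, γ x ∈ S2
  contDiff : ContDiff ℝ 2 (fun t : ℝ => γ (t : S1))
  regular : ∀ x, circleDeriv γ x ≠ 0
  simple : Function.Injective γ

/-- The geodesic curvature in `S²` of a regular spherical curve, with respect to the unit normal
`γ × γ' / ‖γ'‖`: this is `⟨∇_T T, N⟩ = ⟨γ'', γ × γ'⟩ / ‖γ'‖³`. -/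
def geodesicCurvature (γ : S1 → E3) (x : S1) : ℝ :=
  inner ℝ (circleDeriv (circleDeriv γ) x) (cross (γ x) (circleDeriv γ x)) / ‖circleDeriv γ x‖ ^ 3

/-- Some nondegenerate subarc of the curve is a geodesic, that is, the geodesic curvature vanishes
identically along it. -/
def HasGeodesicSubarc (γ : S1 → E3) : Prop :=
  ∃ a b : ℝ, a < b ∧ ∀ t ∈ Icc a b, geodesicCurvature γ (t : S1) = 0

/-- The great circle of `S²` in the plane through the origin orthogonal to `u`. -/
def greatCircle (u : E3) : Set E3 := {x | x ∈ S2 ∧ inner ℝ u x = 0}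

/-- The closed hemisphere of `S²` centered at `u`; its boundary is `greatCircle u`. -/
def hemisphere (u : E3) : Set E3 := {x | x ∈ S2 ∧ 0 ≤ inner ℝ u x}

/-- `C` is a great circle and `Γ` lies in one of the two closed hemispheres bounded by `C`. -/
def IsCircumscribedIn (Γ C : Set E3) : Prop :=
  ∃ u ∈ S2, C = greatCircle u ∧ Γ ⊆ hemisphere u

/-- The open semicircle of the great circle `C` with midpoint `v ∈ C`. -/
def openSemicircle (C : Set E3) (v : E3) : Set E3 := {x | x ∈ C ∧ 0 < inner ℝ v x}

/-- `f` changes sign (at least) `m` times on the circle: there are `m` points of the circle, listed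
in cyclic order (by increasing angles within one turn), at which `f` does not vanish, such that `f`
has opposite signs at cyclically consecutive points. -/
def ChangesSign (f : S1 → ℝ) (m : ℕ) : Prop :=
  ∃ t : Fin m → ℝ, StrictMono t ∧ (∀ i j, t j < t i + 2 * Real.pi) ∧
    ∀ i, f (t i : S1) ≠ 0 ∧
      SignType.sign (f (t i : S1)) = -SignType.sign (f (t (finRotate m i) : S1))

/-- The (parameters of the) inflections of the curve. -/
def inflections (γ : S1 → E3) : Set S1 := {x | geodesicCurvature γ x = 0}

/-- The genuine inflections: those with a connected open neighborhood in which the geodesic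
curvature vanishes only once and changes sign. -/
def genuineInflections (γ : S1 → E3) : Set S1 :=
  {x | x ∈ inflections γ ∧ ∃ U : Set S1, IsOpen U ∧ IsConnected U ∧ x ∈ U ∧
    (∀ y ∈ U, geodesicCurvature γ y = 0 → y = x) ∧
    (∃ y ∈ U, 0 < geodesicCurvature γ y) ∧ ∃ y ∈ U, geodesicCurvature γ y < 0}

end SphericalCurve

end

noncomputable section

namespace SphericalCurve

open Set Filter Topology Complex
open scoped Real ComplexConjugate

/-! Project Γ orthogonally to the plane of C. The height `h` is nonnegative, hence determined by the
projection `c`, so `c` is again a simple closed regular curve. It lies in the unit disk and meets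
the unit circle exactly in the projections of Γ ∩ C. The determinant `curvDet` has the sign of the
geodesic curvature k.

Following Hopf, the secants of `c` carry a continuous argument that extends to the tangents. At a
contact with the unit circle all secants lie on one side of the tangent. Hence all contacts are
traversed in the same direction (`east_of_east`), counterclockwise after a reflection; the tangent
angle Θ increases from contact to contact (`tangentArg_lt`) and gains 2π in one turn. At a contact Θ
exceeds the polar angle by π/2, so contacts not contained in an open semicircle leave gaps over
which Θ increases by at most π (`turn_le_pi`).

On an arc over (a, b) between neighboring contacts the central projection c/h comes from infinity
and returns to it, in directions of angles Θ(a) + π/2 and Θ(b) - π/2, and its direction turns with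
the sign of k. If k ≥ 0 there, then Θ(b) - Θ(a) ≥ π; the opposite bound makes the direction constant
and the arc a geodesic (`curvDet_eq_zero_of_nonneg`). So k < 0 somewhere in each gap. Just after
each contact k > 0 somewhere, since otherwise the curve could not leave C into the hemisphere
(`exists_curvDet_pos`). These n negative and n positive values alternate. -/

/-- `θ` is an argument of the nonzero complex number `z`. -/
def HasArg (z : ℂ) (θ : ℝ) : Prop := ∃ r : ℝ, 0 < r ∧ z = r * exp (θ * I)

/-! ### Arguments of complex numbers as real angles -/

namespace HasArg

variable {z w : ℂ} {θ η : ℝ}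

theorem ne_zero (h : HasArg z θ) : z ≠ 0 := by
  obtain ⟨r, hr, rfl⟩ := h
  exact mul_ne_zero (ofReal_ne_zero.2 hr.ne') (exp_ne_zero _)

theorem of_exp_eq {L : ℂ} (h : exp L = z) : HasArg z L.im := by
  refine ⟨Real.exp L.re, Real.exp_pos _, ?_⟩
  rw [← h, ofReal_exp, ← exp_add, re_add_im]

theorem arg (hz : z ≠ 0) : HasArg z z.arg :=
  ⟨‖z‖, norm_pos_iff.2 hz, (norm_mul_exp_arg_mul_I z).symm⟩

theorem real_mul (h : HasArg z θ) {a : ℝ} (ha : 0 < a) : HasArg (a * z) θ := by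
  obtain ⟨r, hr, rfl⟩ := h
  exact ⟨a * r, mul_pos ha hr, by push_cast; ring⟩

theorem of_real_mul {a : ℝ} (ha : 0 < a) (h : HasArg (a * z) θ) : HasArg z θ := by
  have := h.real_mul (inv_pos.2 ha)
  rwa [← mul_assoc, ← ofReal_mul, inv_mul_cancel₀ ha.ne', ofReal_one, one_mul] at this

theorem mul (h : HasArg z θ) (h' : HasArg w η) : HasArg (z * w) (θ + η) := by
  obtain ⟨r, hr, rfl⟩ := h
  obtain ⟨s, hs, rfl⟩ := h'
  refine ⟨r * s, mul_pos hr hs, ?_⟩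
  push_cast
  rw [add_mul, exp_add]
  ring

theorem star (h : HasArg z θ) : HasArg (conj z) (-θ) := by
  obtain ⟨r, hr, rfl⟩ := h
  refine ⟨r, hr, ?_⟩
  rw [map_mul, conj_ofReal, ← exp_conj, map_mul, conj_ofReal, conj_I]
  push_cast
  ring_nf

theorem im_eq (h : HasArg z θ) : ∃ r : ℝ, 0 < r ∧ z.im = r * Real.sin θ := by
  obtain ⟨r, hr, rfl⟩ := h
  exact ⟨r, hr, by rw [im_ofReal_mul, exp_ofReal_mul_I_im]⟩

theorem re_eq (h : HasArg z θ) : ∃ r : ℝ, 0 < r ∧ z.re = r * Real.cos θ := by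
  obtain ⟨r, hr, rfl⟩ := h
  exact ⟨r, hr, by rw [re_ofReal_mul, exp_ofReal_mul_I_re]⟩

theorem sin_pos_iff (h : HasArg z θ) : 0 < Real.sin θ ↔ 0 < z.im := by
  obtain ⟨r, hr, e⟩ := h.im_eq
  rw [e, mul_pos_iff_of_pos_left hr]

theorem cos_eq_neg_one (h : HasArg z θ) (hi : z.im = 0) (hr : z.re < 0) : Real.cos θ = -1 := by
  obtain ⟨r, h1, e⟩ := h.im_eq
  obtain ⟨s, h2, e'⟩ := h.re_eq
  have h3 : Real.sin θ = 0 := by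
    rw [hi] at e
    rcases mul_eq_zero.1 e.symm with h | h
    · exact absurd h h1.ne'
    · exact h
  have h4 : Real.cos θ < 0 := by
    by_contra! hc
    have := mul_nonneg h2.le hc
    linarith
  have := Real.sin_sq_add_cos_sq θ
  rw [h3] at this
  nlinarith

/-- Two arguments of the same number differ by a multiple of `2π`. -/
theorem sub_eq (h : HasArg z θ) (h' : HasArg z η) : ∃ k : ℤ, θ - η = k * (2 * π) := by
  obtain ⟨r, hr, rfl⟩ := h
  obtain ⟨s, hs, e⟩ := h'
  have hrs : r = s := by
    have := congrArg norm e
    simpa [norm_exp_ofReal_mul_I, abs_of_pos hr, abs_of_pos hs] using this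
  subst hrs
  have h1 := mul_left_cancel₀ (ofReal_ne_zero.2 hr.ne') e
  obtain ⟨k, hk⟩ := exp_eq_exp_iff_exists_int.1 h1
  refine ⟨k, ?_⟩
  have := congrArg im hk
  simp at this
  linarith

end HasArg

/-- Two continuous determinations of the argument on a connected set differ by a constant. -/
theorem HasArg.sub_const {X : Type*} [TopologicalSpace X] {S : Set X} (hS : IsPreconnected S)
    {z : X → ℂ} {φ ψ : X → ℝ} (hφ : ContinuousOn φ S) (hψ : ContinuousOn ψ S)
    (h : ∀ x ∈ S, HasArg (z x) (φ x)) (h' : ∀ x ∈ S, HasArg (z x) (ψ x))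
    {x y : X} (hx : x ∈ S) (hy : y ∈ S) : φ x - ψ x = φ y - ψ y := by
  have key : ∀ x ∈ S, ∀ y ∈ S, ¬ (φ x - ψ x < φ y - ψ y) := by
    intro x hx y hy hlt
    obtain ⟨k, hk⟩ := (h x hx).sub_eq (h' x hx)
    obtain ⟨l, hl⟩ := (h y hy).sub_eq (h' y hy)
    have hpi := Real.pi_pos
    have hkl : k + 1 ≤ l := by
      rw [hk, hl] at hlt
      have : (k : ℝ) < l := lt_of_mul_lt_mul_right hlt (by positivity)
      exact_mod_cast this
    have hkl' : (k : ℝ) + 1 ≤ l := by exact_mod_cast hkl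
    -- The difference takes values in 2πℤ, but if it were not constant it would also attain an odd
    -- multiple of π.
    obtain ⟨w, hw, hw'⟩ := (hS.image _ (hφ.sub hψ)).Icc_subset (mem_image_of_mem _ hx)
      (mem_image_of_mem _ hy) (show φ x - ψ x + π ∈ Icc (φ x - ψ x) (φ y - ψ y) from
        ⟨by linarith, by rw [hk, hl]; nlinarith⟩)
    obtain ⟨m, hm⟩ := (h w hw).sub_eq (h' w hw)
    simp only [Pi.sub_apply] at hw'
    rw [hm, hk] at hw'
    have : (m : ℝ) * 2 = k * 2 + 1 := by
      apply mul_right_cancel₀ hpi.ne'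
      linarith
    have : m * 2 = k * 2 + 1 := by exact_mod_cast this
    omega
  exact le_antisymm (not_lt.1 (key y hy x hx)) (not_lt.1 (key x hx y hy))

/-! ### Hopf's secant map of a simple closed plane curve -/

/-- The mean velocity of `c` between the times `s` and `s + r`. -/
def meanVelocity (c : ℝ → ℂ) (s r : ℝ) : ℂ := ∫ u in (0 : ℝ)..1, deriv c (s + u * r)

theorem continuous_meanVelocity {c : ℝ → ℂ} (hc : ContDiff ℝ 1 c) :
    Continuous fun x : ℝ × ℝ => meanVelocity c x.1 x.2 := by
  have h1 : Continuous (deriv c) := hc.continuous_deriv le_rfl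
  unfold meanVelocity
  apply intervalIntegral.continuous_parametric_intervalIntegral_of_continuous'
  fun_prop

theorem meanVelocity_zero (c : ℝ → ℂ) (s : ℝ) : meanVelocity c s 0 = deriv c s := by
  simp [meanVelocity]

theorem mul_meanVelocity {c : ℝ → ℂ} (hc : ContDiff ℝ 1 c) (s r : ℝ) :
    r * meanVelocity c s r = c (s + r) - c s := by
  have h1 : Continuous (deriv c) := hc.continuous_deriv le_rfl
  have h2 : ∀ u : ℝ, HasDerivAt (fun u : ℝ => c (s + u * r)) (r * deriv c (s + u * r)) u := by
    intro u
    have := ((hc.differentiable one_ne_zero) (s + u * r)).hasDerivAt.scomp u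
      (((hasDerivAt_id u).mul_const r).const_add s)
    simpa [Function.comp_def] using this
  have h3 := intervalIntegral.integral_eq_sub_of_hasDerivAt (a := 0) (b := 1)
    (fun u _ => h2 u) (Continuous.intervalIntegrable (by fun_prop) _ _)
  rw [intervalIntegral.integral_const_mul] at h3
  simpa [meanVelocity] using h3

/-- The secants of a simple closed regular plane curve have a continuous argument, which extends
to the tangents. -/
theorem exists_secant_arg {c : ℝ → ℂ} (hc : ContDiff ℝ 1 c) (hper : Function.Periodic c (2 * π))
    (hreg : ∀ t, deriv c t ≠ 0) (hinj : ∀ s r, 0 < r → r < 2 * π → c (s + r) ≠ c s) :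
    ∃ φ : ℝ → ℝ → ℝ, Continuous (fun x : ℝ × ℝ => φ x.1 x.2) ∧
      (∀ s r, 0 < r → r < 2 * π → HasArg (c (s + r) - c s) (φ s r)) ∧
      (∀ s, HasArg (deriv c s) (φ s 0)) ∧ ∀ s, HasArg (-deriv c s) (φ s (2 * π)) := by
  have hpi := Real.pi_pos
  have hD := continuous_meanVelocity hc
  have hperd : ∀ s, deriv c (s + 2 * π) = deriv c s := fun s => by
    rw [← deriv_comp_add_const]
    congr 1
    exact funext hper
  -- Clamping `r` to [0, 2π] extends the secant map to the whole plane, which is open and simply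
  -- connected.
  set ρ : ℝ → ℝ := fun r => max 0 (min r (2 * π)) with hρ
  have hρc : Continuous ρ := by fun_prop
  have hρ0 : ∀ r, 0 ≤ ρ r := fun r => le_max_left _ _
  have hρ1 : ∀ r, ρ r ≤ 2 * π := fun r => max_le (by positivity) (min_le_right _ _)
  have hρi : ∀ r, 0 ≤ r → r ≤ 2 * π → ρ r = r := fun r h0 h1 => by
    simp only [hρ]
    rw [min_eq_left h1, max_eq_right h0]
  -- For 0 < r < 2π this is the secant divided by r(2π - r), so that the zeros at both ends are
  -- removed. The second branch uses periodicity: c(s + r) - c(s) = -(c(s + 2π) - c(s + r)).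
  set G : ℝ × ℝ → ℂ := fun x => if ρ x.2 ≤ π then (2 * π - ρ x.2 : ℝ)⁻¹ * meanVelocity c x.1 (ρ x.2)
    else ((max (ρ x.2) π)⁻¹ : ℝ) * -meanVelocity c (x.1 + ρ x.2) (2 * π - ρ x.2) with hG
  have hGc : Continuous G := by
    have e1 : Continuous fun x : ℝ × ℝ =>
        ((2 * π - min (ρ x.2) π : ℝ)⁻¹ : ℝ) * meanVelocity c x.1 (ρ x.2) := by
      apply Continuous.mul
      · refine continuous_ofReal.comp (Continuous.inv₀ (by fun_prop) fun x => ?_)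
        have := min_le_right (ρ x.2) π
        linarith
      · exact hD.comp (by fun_prop : Continuous fun x : ℝ × ℝ => (x.1, ρ x.2))
    have e2 : Continuous fun x : ℝ × ℝ =>
        ((max (ρ x.2) π)⁻¹ : ℝ) * -meanVelocity c (x.1 + ρ x.2) (2 * π - ρ x.2) := by
      apply Continuous.mul
      · refine continuous_ofReal.comp (Continuous.inv₀ (by fun_prop) fun x => ?_)
        have := le_max_right (ρ x.2) π
        linarith
      · exact (hD.comp (by fun_prop :
          Continuous fun x : ℝ × ℝ => (x.1 + ρ x.2, 2 * π - ρ x.2))).neg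
    have e3 : G = fun x : ℝ × ℝ => if ρ x.2 ≤ π then
        ((2 * π - min (ρ x.2) π : ℝ)⁻¹ : ℝ) * meanVelocity c x.1 (ρ x.2) else
        ((max (ρ x.2) π)⁻¹ : ℝ) * -meanVelocity c (x.1 + ρ x.2) (2 * π - ρ x.2) := by
      funext x
      simp only [hG]
      split_ifs with h
      · rw [min_eq_left h]
      · rfl
    rw [e3]
    refine Continuous.if_le e1 e2 (by fun_prop) continuous_const fun x hx => ?_
    rw [hx, min_self, max_self]
    have a1 := mul_meanVelocity hc x.1 π
    have a2 := mul_meanVelocity hc (x.1 + π) π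
    have a3 : c (x.1 + π + π) = c x.1 := by rw [← hper x.1]; ring_nf
    rw [a3] at a2
    have hpc : (π : ℂ) ≠ 0 := ofReal_ne_zero.2 hpi.ne'
    have a4 : meanVelocity c x.1 π = -meanVelocity c (x.1 + π) π := by
      apply mul_left_cancel₀ hpc
      rw [mul_neg, a1, a2]
      ring
    have a5 : 2 * π - π = π := by ring
    rw [a5, a4]
  have hGr : ∀ s r, 0 < r → r < 2 * π → ∃ a : ℝ, 0 < a ∧ c (s + r) - c s = a * G (s, r) := by
    intro s r h0 h1
    have hr := hρi r h0.le h1.le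
    simp only [hG, hr]
    split_ifs with h
    · have h2 : 0 < 2 * π - r := by linarith
      refine ⟨r * (2 * π - r), by positivity, ?_⟩
      rw [← mul_meanVelocity hc]
      have : ((2 * π - r : ℝ) : ℂ) ≠ 0 := ofReal_ne_zero.2 h2.ne'
      push_cast at this ⊢
      field_simp
    · have h2 : 0 < 2 * π - r := by linarith
      refine ⟨r * (2 * π - r), by positivity, ?_⟩
      rw [max_eq_left (by linarith)]
      have a1 := mul_meanVelocity hc (s + r) (2 * π - r)
      have a2 : s + r + (2 * π - r) = s + 2 * π := by ring
      rw [a2, hper] at a1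
      have : (r : ℂ) ≠ 0 := ofReal_ne_zero.2 h0.ne'
      rw [← neg_sub, ← a1]
      push_cast
      field_simp
  have hG0 : ∀ s, ∃ a : ℝ, 0 < a ∧ deriv c s = a * G (s, 0) := by
    intro s
    refine ⟨2 * π, by positivity, ?_⟩
    simp only [hG, hρi 0 le_rfl (by positivity), hpi.le, if_true, meanVelocity_zero]
    have : (π : ℂ) ≠ 0 := ofReal_ne_zero.2 hpi.ne'
    push_cast
    field_simp
    simp only [sub_zero]
    ring
  have hG1 : ∀ s, ∃ a : ℝ, 0 < a ∧ -deriv c s = a * G (s, 2 * π) := by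
    intro s
    refine ⟨2 * π, by positivity, ?_⟩
    have h2 : ¬ (2 * π ≤ π) := by linarith
    simp only [hG, hρi (2 * π) (by positivity) le_rfl, h2, if_false, sub_self, meanVelocity_zero,
      hperd]
    rw [max_eq_left (by linarith)]
    have : (π : ℂ) ≠ 0 := ofReal_ne_zero.2 hpi.ne'
    push_cast
    field_simp
  have hGρ : ∀ s r, G (s, r) = G (s, ρ r) := by
    intro s r
    simp only [hG, hρi (ρ r) (hρ0 r) (hρ1 r)]
  have hGne : ∀ x, G x ≠ 0 := by
    rintro ⟨s, r⟩ h
    rw [hGρ] at h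
    rcases (hρ0 r).eq_or_lt with h0 | h0
    · obtain ⟨a, _, e⟩ := hG0 s
      rw [h0, h, mul_zero] at e
      exact hreg s e
    · rcases (hρ1 r).eq_or_lt with h1 | h1
      · obtain ⟨a, _, e⟩ := hG1 s
        rw [← h1, h, mul_zero, neg_eq_zero] at e
        exact hreg s e
      · obtain ⟨a, _, e⟩ := hGr s (ρ r) h0 h1
        rw [h, mul_zero, sub_eq_zero] at e
        exact hinj s _ h0 h1 e
  -- The nowhere vanishing `G` has a continuous logarithm, whose imaginary part is the required
  -- argument.
  have hU : IsSimplyConnected (univ : Set (ℝ × ℝ)) :=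
    have := (convex_univ (𝕜 := ℝ) (E := ℝ × ℝ)).contractibleSpace univ_nonempty
    show SimplyConnectedSpace (univ : Set (ℝ × ℝ)) from inferInstance
  obtain ⟨L, hL, hL'⟩ := exists_continuousOn_eqOn_exp_comp (X := ℝ × ℝ) (U := univ)
    hU isOpen_univ hGc.continuousOn
    (by rintro ⟨x, -, hx⟩; exact hGne x hx)
  have hLG : ∀ x, HasArg (G x) (L x).im := fun x => HasArg.of_exp_eq (hL' (mem_univ x))
  refine ⟨fun s r => (L (s, r)).im, continuous_im.comp (continuousOn_univ.1 hL), ?_, ?_, ?_⟩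
  · intro s r h0 h1
    obtain ⟨a, ha, e⟩ := hGr s r h0 h1
    rw [e]
    exact (hLG _).real_mul ha
  · intro s
    obtain ⟨a, ha, e⟩ := hG0 s
    rw [e]
    exact (hLG _).real_mul ha
  · intro s
    obtain ⟨a, ha, e⟩ := hG1 s
    rw [e]
    exact (hLG _).real_mul ha

/-! ### Curves in a closed hemisphere and their contacts with its boundary -/

/-- `t ↦ (c t, h t) ∈ ℂ × ℝ` is a regular simple closed `C²` curve in the closed upper half of the
unit sphere. -/
structure HemisphereCurve (c : ℝ → ℂ) (h : ℝ → ℝ) : Prop where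
  contDiff_c : ContDiff ℝ 2 c
  contDiff_h : ContDiff ℝ 2 h
  periodic_c : Function.Periodic c (2 * π)
  periodic_h : Function.Periodic h (2 * π)
  sphere : ∀ t, (c t).re ^ 2 + (c t).im ^ 2 + h t ^ 2 = 1
  nonneg : ∀ t, 0 ≤ h t
  regular : ∀ t, deriv c t = 0 → deriv h t ≠ 0
  simple : ∀ s r, 0 < r → r < 2 * π → c (s + r) ≠ c s

/-- A continuous function vanishing at the left end of an interval, whose sine is positive in the
interval, takes its values between `0` and `π`. -/
theorem mem_Ioo_of_sin_pos {g : ℝ → ℝ} {b : ℝ} (hg : ContinuousOn g (Icc 0 b))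
    (h0 : g 0 = 0) (hs : ∀ x ∈ Ioo 0 b, 0 < Real.sin (g x)) : ∀ x ∈ Ioo 0 b, g x ∈ Ioo 0 π := by
  have hpi := Real.pi_pos
  intro x hx
  have hb : 0 < b := hx.1.trans hx.2
  have hgo : ContinuousOn g (Ioo 0 b) := hg.mono Ioo_subset_Icc_self
  have him := (isPreconnected_Ioo (a := 0) (b := b)).image g hgo
  have hne : ∀ y ∈ Ioo 0 b, g y ≠ 0 ∧ g y ≠ π := fun y hy =>
    ⟨fun e => by have := hs y hy; simp [e] at this, fun e => by have := hs y hy; simp [e] at this⟩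
  -- Near the left end `g` is close to 0, which rules out the other intervals where the sine is
  -- positive. Elsewhere `g` cannot cross 0 or π.
  obtain ⟨y, hy, hy1, hy2⟩ : ∃ y ∈ Ioo 0 b, -π < g y ∧ g y < π := by
    have h1 : Tendsto g (𝓝[>] 0) (𝓝 0) := by
      have := (hg 0 (left_mem_Icc.2 hb.le)).tendsto
      rw [h0] at this
      refine this.mono_left ?_
      rw [← nhdsWithin_Ioo_eq_nhdsGT hb]
      exact nhdsWithin_mono _ Ioo_subset_Icc_self
    have h2 : ∀ᶠ x in 𝓝[>] 0, g x ∈ Ioo (-π) π := h1 (Ioo_mem_nhds (neg_neg_of_pos hpi) hpi)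
    obtain ⟨y, hy, hy'⟩ := (h2.and (Ioo_mem_nhdsGT hb)).exists
    exact ⟨y, hy', hy⟩
  have hy0 : 0 < g y := by
    by_contra! hle
    rcases hle.eq_or_lt with h | h
    · exact (hne y hy).1 h
    · exact absurd (hs y hy) (not_lt.2 (Real.sin_nonpos_of_nonpos_of_neg_pi_le h.le hy1.le))
  constructor
  · by_contra! hle
    obtain ⟨w, hw, hw'⟩ := him.Icc_subset (mem_image_of_mem g hx) (mem_image_of_mem g hy)
      ⟨hle, hy0.le⟩
    exact (hne w hw).1 hw'
  · by_contra! hle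
    obtain ⟨w, hw, hw'⟩ := him.Icc_subset (mem_image_of_mem g hy) (mem_image_of_mem g hx)
      ⟨hy2.le, hle⟩
    exact (hne w hw).2 hw'

theorem eq_pi_of_sin_pos {g : ℝ → ℝ} {b : ℝ} (hb : 0 < b) (hg : ContinuousOn g (Icc 0 b))
    (h0 : g 0 = 0) (hs : ∀ x ∈ Ioo 0 b, 0 < Real.sin (g x)) (h1 : Real.cos (g b) = -1) :
    g b = π := by
  have hpi := Real.pi_pos
  have hm := mem_Ioo_of_sin_pos hg h0 hs
  have h2 : g b ∈ Icc 0 π := by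
    have hc : closure (Ioo 0 b) = Icc 0 b := closure_Ioo hb.ne
    have h3 := ContinuousWithinAt.mem_closure (t := Icc 0 π)
      ((hg b (right_mem_Icc.2 hb.le)).mono Ioo_subset_Icc_self)
      (by rw [hc]; exact right_mem_Icc.2 hb.le) (fun x hx => Ioo_subset_Icc_self (hm x hx))
    rwa [isClosed_Icc.closure_eq] at h3
  exact Real.injOn_cos h2 ⟨hpi.le, le_rfl⟩ (by rw [h1, Real.cos_pi])

theorem hasDerivAt_re_comp {w : ℝ → ℂ} {w' : ℂ} {t : ℝ} (hw : HasDerivAt w w' t) :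
    HasDerivAt (fun t => (w t).re) w'.re t :=
  (reCLM.hasFDerivAt (x := w t)).comp_hasDerivAt t hw

theorem hasDerivAt_im_comp {w : ℝ → ℂ} {w' : ℂ} {t : ℝ} (hw : HasDerivAt w w' t) :
    HasDerivAt (fun t => (w t).im) w'.im t :=
  (imCLM.hasFDerivAt (x := w t)).comp_hasDerivAt t hw

theorem hasDerivAt_conj_comp {w : ℝ → ℂ} {w' : ℂ} {t : ℝ} (hw : HasDerivAt w w' t) :
    HasDerivAt (fun t => conj (w t)) (conj w') t :=
  (conjCLE.hasFDerivAt (x := w t)).comp_hasDerivAt t hw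

namespace HemisphereCurve

variable {c : ℝ → ℂ} {h : ℝ → ℝ}

theorem hasDerivAt_c (H : HemisphereCurve c h) (t : ℝ) : HasDerivAt c (deriv c t) t :=
  (H.contDiff_c.differentiable two_ne_zero t).hasDerivAt

theorem hasDerivAt_h (H : HemisphereCurve c h) (t : ℝ) : HasDerivAt h (deriv h t) t :=
  (H.contDiff_h.differentiable two_ne_zero t).hasDerivAt

theorem contDiff_deriv_c (H : HemisphereCurve c h) : ContDiff ℝ 1 (deriv c) :=
  (contDiff_succ_iff_deriv.1 H.contDiff_c).2.2

theorem contDiff_deriv_h (H : HemisphereCurve c h) : ContDiff ℝ 1 (deriv h) :=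
  (contDiff_succ_iff_deriv.1 H.contDiff_h).2.2

theorem hasDerivAt_deriv_c (H : HemisphereCurve c h) (t : ℝ) :
    HasDerivAt (deriv c) (deriv (deriv c) t) t :=
  (H.contDiff_deriv_c.differentiable one_ne_zero t).hasDerivAt

theorem hasDerivAt_deriv_h (H : HemisphereCurve c h) (t : ℝ) :
    HasDerivAt (deriv h) (deriv (deriv h) t) t :=
  (H.contDiff_deriv_h.differentiable one_ne_zero t).hasDerivAt

theorem periodic_deriv_c (H : HemisphereCurve c h) : Function.Periodic (deriv c) (2 * π) :=
  fun s => by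
    rw [← deriv_comp_add_const]
    congr 1
    exact funext H.periodic_c

theorem orthogonal (H : HemisphereCurve c h) (t : ℝ) :
    (c t).re * (deriv c t).re + (c t).im * (deriv c t).im + h t * deriv h t = 0 := by
  have h1 := (((hasDerivAt_re_comp (H.hasDerivAt_c t)).pow 2).add
    ((hasDerivAt_im_comp (H.hasDerivAt_c t)).pow 2)).add
    ((H.hasDerivAt_h t).pow 2)
  have h2 := h1.unique ((hasDerivAt_const t (1 : ℝ)).congr_of_eventuallyEq
    (Eventually.of_forall fun s => H.sphere s))
  simp at h2
  linarith

theorem deriv_h_eq_zero (H : HemisphereCurve c h) {t : ℝ} (ht : h t = 0) : deriv h t = 0 :=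
  IsLocalMin.deriv_eq_zero (Eventually.of_forall fun s => by rw [ht]; exact H.nonneg s)

/-- A vertical velocity orthogonal to the position forces height 0. But the height is minimal there,
so the vertical velocity vanishes too. -/
theorem deriv_c_ne_zero (H : HemisphereCurve c h) (t : ℝ) : deriv c t ≠ 0 := by
  intro h0
  have h1 := H.regular t h0
  have h2 := H.orthogonal t
  rw [h0] at h2
  have h3 : h t = 0 := by simpa [h1] using h2
  exact h1 (H.deriv_h_eq_zero h3)

/-- The mirror image exchanges counterclockwise and clockwise contacts, so it suffices to treat the
former. -/
theorem conjugate (H : HemisphereCurve c h) : HemisphereCurve (fun t => conj (c t)) h where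
  contDiff_c := conjCLE.contDiff.comp H.contDiff_c
  contDiff_h := H.contDiff_h
  periodic_c := fun t => by simp only [H.periodic_c t]
  periodic_h := H.periodic_h
  sphere := fun t => by simpa using H.sphere t
  nonneg := H.nonneg
  regular := fun t ht => H.regular t (by
    rw [(hasDerivAt_conj_comp (H.hasDerivAt_c t)).deriv] at ht
    simpa using ht)
  simple := fun s r h0 h1 e => H.simple s r h0 h1 ((starRingEnd ℂ).injective e)

theorem deriv_conj (H : HemisphereCurve c h) :
    deriv (fun t => (starRingEnd ℂ) (c t)) = fun t => (starRingEnd ℂ) (deriv c t) :=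
  funext fun t => (hasDerivAt_conj_comp (H.hasDerivAt_c t)).deriv

theorem normSq_eq_one (H : HemisphereCurve c h) {t : ℝ} (ht : h t = 0) :
    (c t).re ^ 2 + (c t).im ^ 2 = 1 := by
  have := H.sphere t
  rw [ht] at this
  linarith

/-- At a point of the boundary great circle the curve is tangent to this circle. -/
theorem exists_deriv_eq (H : HemisphereCurve c h) {t : ℝ} (ht : h t = 0) :
    ∃ μ : ℝ, μ ≠ 0 ∧ deriv c t = μ * I * c t := by
  have h1 := H.normSq_eq_one ht
  have h2 := H.orthogonal t
  rw [ht] at h2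
  have h3 : deriv c t = ((c t).re * (deriv c t).im - (c t).im * (deriv c t).re : ℝ) * I * c t := by
    apply Complex.ext
    · simp
      linear_combination (-(deriv c t).re) * h1 + (c t).re * h2
    · simp
      linear_combination (-(deriv c t).im) * h1 + (c t).im * h2
  refine ⟨_, fun e => H.deriv_c_ne_zero t ?_, h3⟩
  rw [h3, e]
  simp

/-- The curve touches the boundary circle at `t`, running counterclockwise. -/
def East (c : ℝ → ℂ) (h : ℝ → ℝ) (t : ℝ) : Prop := h t = 0 ∧ ∃ μ : ℝ, 0 < μ ∧ deriv c t = μ * I * c t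

/-- The disk is strictly convex. -/
theorem inner_lt_one (H : HemisphereCurve c h) {s t : ℝ} (ht : h t = 0) (hne : c s ≠ c t) :
    (c t).re * (c s).re + (c t).im * (c s).im < 1 := by
  have h1 := H.normSq_eq_one ht
  have h2 := H.sphere s
  have h3 : 0 < ((c s).re - (c t).re) ^ 2 + ((c s).im - (c t).im) ^ 2 := by
    by_contra! hle
    apply hne
    apply Complex.ext
    · nlinarith [sq_nonneg ((c s).re - (c t).re), sq_nonneg ((c s).im - (c t).im)]
    · nlinarith [sq_nonneg ((c s).re - (c t).re), sq_nonneg ((c s).im - (c t).im)]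
  nlinarith [sq_nonneg (h s)]

end HemisphereCurve

/-! ### Rotation of the tangent between contacts -/

namespace HemisphereCurve

variable {c : ℝ → ℂ} {h : ℝ → ℝ}

theorem East.add_two_pi (H : HemisphereCurve c h) {t : ℝ} (ht : East c h t) :
    East c h (t + 2 * π) := by
  obtain ⟨h0, μ, hμ, e⟩ := ht
  exact ⟨by rw [H.periodic_h, h0], μ, hμ, by rw [H.periodic_deriv_c, H.periodic_c, e]⟩

theorem eq_or_of_contact (H : HemisphereCurve c h) {t : ℝ} (ht : h t = 0) :
    East c h t ∨ East (fun t => conj (c t)) h t := by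
  obtain ⟨μ, hμ, e⟩ := H.exists_deriv_eq ht
  rcases hμ.lt_or_gt with hlt | hgt
  · refine Or.inr ⟨ht, -μ, by linarith, ?_⟩
    rw [H.deriv_conj]
    simp [e]
  · exact Or.inl ⟨ht, μ, hgt, e⟩

/-- A continuous determination `φ s r` of the argument of the secant from `c s` to `c (s + r)`. -/
structure IsSecantArg (c : ℝ → ℂ) (φ : ℝ → ℝ → ℝ) : Prop where
  cont : Continuous fun x : ℝ × ℝ => φ x.1 x.2
  secant : ∀ s r, 0 < r → r < 2 * π → HasArg (c (s + r) - c s) (φ s r)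
  tangent : ∀ s, HasArg (deriv c s) (φ s 0)
  neg_tangent : ∀ s, HasArg (-deriv c s) (φ s (2 * π))

theorem exists_isSecantArg (H : HemisphereCurve c h) : ∃ φ, IsSecantArg c φ := by
  obtain ⟨φ, h1, h2, h3, h4⟩ := exists_secant_arg (H.contDiff_c.of_le one_le_two) H.periodic_c
    H.deriv_c_ne_zero H.simple
  exact ⟨φ, h1, h2, h3, h4⟩

theorem IsSecantArg.conj (H : HemisphereCurve c h) {φ : ℝ → ℝ → ℝ} (hφ : IsSecantArg c φ) :
    IsSecantArg (fun t => conj (c t)) (fun s r => -φ s r) where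
  cont := hφ.cont.neg
  secant := fun s r h0 h1 => by simpa using (hφ.secant s r h0 h1).star
  tangent := fun s => by simpa [H.deriv_conj] using (hφ.tangent s).star
  neg_tangent := fun s => by simpa [H.deriv_conj] using (hφ.neg_tangent s).star

variable {φ : ℝ → ℝ → ℝ}

/-- The disk is strictly convex, so every secant starting at a counterclockwise contact points
strictly to the left of the tangent. -/
theorem row_sin_pos (H : HemisphereCurve c h) (hφ : IsSecantArg c φ) {s : ℝ} (hs : East c h s) :
    ∀ r ∈ Ioo 0 (2 * π), 0 < Real.sin (φ s r - φ s 0) := by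
  rintro r ⟨h0, h1⟩
  obtain ⟨hs0, μ, hμ, e⟩ := hs
  have h2 := (hφ.secant s r h0 h1).mul (hφ.tangent s).star
  rw [← sub_eq_add_neg] at h2
  rw [h2.sin_pos_iff, e]
  have h3 := H.inner_lt_one hs0 (H.simple s r h0 h1)
  have h4 := H.normSq_eq_one hs0
  have : ((c (s + r) - c s) * conj (μ * I * c s)).im =
      μ * (1 - ((c s).re * (c (s + r)).re + (c s).im * (c (s + r)).im)) := by
    simp
    linear_combination μ * h4
  rw [this]
  exact mul_pos hμ (by linarith)

theorem row_mem (H : HemisphereCurve c h) (hφ : IsSecantArg c φ) {s : ℝ} (hs : East c h s) :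
    ∀ r ∈ Ioo 0 (2 * π), φ s r - φ s 0 ∈ Ioo 0 π :=
  mem_Ioo_of_sin_pos (g := fun r => φ s r - φ s 0)
    ((hφ.cont.comp (by fun_prop : Continuous fun r : ℝ => (s, r))).sub continuous_const).continuousOn
    (sub_self _) (H.row_sin_pos hφ hs)

theorem cos_half_turn (H : HemisphereCurve c h) (hφ : IsSecantArg c φ) (s : ℝ) :
    Real.cos (φ s (2 * π) - φ s 0) = -1 := by
  have h2 := (hφ.neg_tangent s).mul (hφ.tangent s).star
  rw [← sub_eq_add_neg] at h2
  have hne := H.deriv_c_ne_zero s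
  have h3 : 0 < normSq (deriv c s) := normSq_pos.2 hne
  have h4 : -deriv c s * conj (deriv c s) = ((-normSq (deriv c s) : ℝ) : ℂ) := by
    rw [neg_mul, mul_conj]
    simp
  rw [h4] at h2
  exact h2.cos_eq_neg_one (ofReal_im _) (by rw [ofReal_re]; linarith)

theorem row_end (H : HemisphereCurve c h) (hφ : IsSecantArg c φ) {s : ℝ} (hs : East c h s) :
    φ s (2 * π) - φ s 0 = π :=
  eq_pi_of_sin_pos (g := fun r => φ s r - φ s 0) Real.two_pi_pos
    ((hφ.cont.comp (by fun_prop : Continuous fun r : ℝ => (s, r))).sub continuous_const).continuousOn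
    (sub_self _) (H.row_sin_pos hφ hs) (H.cos_half_turn hφ s)

/-- The counterpart of `row_sin_pos` for the secants that end at the contact. -/
theorem column_sin_pos (H : HemisphereCurve c h) (hφ : IsSecantArg c φ) {t : ℝ} (ht : East c h t) :
    ∀ r ∈ Ioo 0 (2 * π), 0 < Real.sin (φ t 0 - φ (t - r) r) := by
  rintro r ⟨h0, h1⟩
  obtain ⟨ht0, μ, hμ, e⟩ := ht
  have h2 := (hφ.tangent t).mul (hφ.secant (t - r) r h0 h1).star
  rw [← sub_eq_add_neg, sub_add_cancel] at h2
  rw [h2.sin_pos_iff, e]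
  have h5 := H.simple (t - r) r h0 h1
  rw [sub_add_cancel] at h5
  have h3 := H.inner_lt_one ht0 h5.symm
  have h4 := H.normSq_eq_one ht0
  have : (μ * I * c t * conj (c t - c (t - r))).im =
      μ * (1 - ((c t).re * (c (t - r)).re + (c t).im * (c (t - r)).im)) := by
    simp
    linear_combination μ * h4
  rw [this]
  exact mul_pos hμ (by linarith)

theorem column_mem (H : HemisphereCurve c h) (hφ : IsSecantArg c φ) {t : ℝ} (ht : East c h t) :
    ∀ r ∈ Ioo 0 (2 * π), φ t 0 - φ (t - r) r ∈ Ioo 0 π :=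
  mem_Ioo_of_sin_pos (g := fun r => φ t 0 - φ (t - r) r)
    (continuous_const.sub
      (hφ.cont.comp (by fun_prop : Continuous fun r : ℝ => (t - r, r)))).continuousOn
    (by simp) (H.column_sin_pos hφ ht)

theorem column_end (H : HemisphereCurve c h) (hφ : IsSecantArg c φ) {t : ℝ} (ht : East c h t) :
    φ t 0 - φ (t - 2 * π) (2 * π) = π := by
  refine eq_pi_of_sin_pos (g := fun r => φ t 0 - φ (t - r) r) Real.two_pi_pos
    (continuous_const.sub
      (hφ.cont.comp (by fun_prop : Continuous fun r : ℝ => (t - r, r)))).continuousOn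
    (by simp) (H.column_sin_pos hφ ht) ?_
  have h2 := (hφ.tangent t).mul (hφ.neg_tangent (t - 2 * π)).star
  rw [← sub_eq_add_neg] at h2
  have h5 : deriv c (t - 2 * π) = deriv c t := by
    rw [← H.periodic_deriv_c (t - 2 * π), sub_add_cancel]
  have h3 : 0 < normSq (deriv c t) := normSq_pos.2 (H.deriv_c_ne_zero t)
  have h4 : deriv c t * conj (-deriv c t) = ((-normSq (deriv c t) : ℝ) : ℂ) := by
    rw [map_neg, mul_neg, mul_conj]
    simp
  rw [h5, h4] at h2
  exact h2.cos_eq_neg_one (ofReal_im _) (by rw [ofReal_re]; linarith)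

/-- The tangent of the curve makes one full turn. -/
theorem tangentArg_add_two_pi (H : HemisphereCurve c h) (hφ : IsSecantArg c φ) {s : ℝ}
    (hs : East c h s) : φ (s + 2 * π) 0 = φ s 0 + 2 * π := by
  have h1 := H.row_end hφ hs
  have h2 := H.column_end hφ (East.add_two_pi H hs)
  rw [add_sub_cancel_right] at h2
  linarith

/-- The secant from `c s` to `c t` has an angle strictly between those of the two tangents: compare
it with the first as a secant starting at `s`, with the second as one ending at `t`. -/
theorem tangentArg_lt (H : HemisphereCurve c h) (hφ : IsSecantArg c φ) {s t : ℝ}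
    (hs : East c h s) (ht : East c h t) (hst : s < t) (hts : t < s + 2 * π) :
    φ s 0 < φ t 0 := by
  have h1 := (H.row_mem hφ hs (t - s) ⟨by linarith, by linarith⟩).1
  have h2 := (H.column_mem hφ ht (t - s) ⟨by linarith, by linarith⟩).1
  rw [sub_sub_cancel] at h2
  linarith

/-- A simple curve touches the boundary circle always in the same direction. -/
theorem east_of_east (H : HemisphereCurve c h) {s : ℝ} (hs : East c h s) {t : ℝ} (ht : h t = 0) :
    East c h t := by
  refine (H.eq_or_of_contact ht).resolve_right fun hw => ?_
  obtain ⟨φ, hφ⟩ := H.exists_isSecantArg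
  have h1 := H.row_end hφ hs
  have h2 := H.conjugate.row_end (IsSecantArg.conj H hφ) hw
  -- The difference φ s (2π) - φ s 0 is a continuous argument of -1, hence independent of `s`. It is
  -- π at a counterclockwise contact and -π at a clockwise one.
  have h3 := HasArg.sub_const (X := ℝ) (S := univ) (z := fun _ => -1)
    (φ := fun s => φ s (2 * π) - φ s 0) (ψ := fun _ => π) isPreconnected_univ
    ((hφ.cont.comp (by fun_prop : Continuous fun s : ℝ => (s, 2 * π))).sub
      (hφ.cont.comp (by fun_prop : Continuous fun s : ℝ => (s, (0 : ℝ))))).continuousOn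
    continuousOn_const (fun s _ => ?_) (fun s _ => ⟨1, one_pos, by simp⟩)
    (mem_univ s) (mem_univ t)
  · have := Real.pi_pos
    linarith
  · have h3 : 0 < normSq (deriv c s) := normSq_pos.2 (H.deriv_c_ne_zero s)
    refine HasArg.of_real_mul h3 ?_
    have h2 := (hφ.neg_tangent s).mul (hφ.tangent s).star
    rw [← sub_eq_add_neg] at h2
    rwa [mul_neg_one, ← mul_conj, ← neg_mul]

/-- The position of a point of contact on the boundary circle. -/
theorem contact_eq (H : HemisphereCurve c h) (hφ : IsSecantArg c φ) {t : ℝ} (ht : East c h t) :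
    c t = exp ((φ t 0 - π / 2 : ℝ) * I) := by
  obtain ⟨h0, μ, hμ, e⟩ := ht
  have h1 := hφ.tangent t
  rw [e, mul_assoc] at h1
  obtain ⟨r, hr, e1⟩ := HasArg.of_real_mul hμ h1
  have h2 : ‖c t‖ = 1 := by
    rw [← sq_eq_sq₀ (norm_nonneg _) zero_le_one, ← normSq_eq_norm_sq, normSq_apply]
    linarith [H.normSq_eq_one h0]
  have h3 := congrArg norm e1
  rw [norm_mul, norm_mul, norm_I, h2, norm_exp_ofReal_mul_I, norm_real, Real.norm_eq_abs,
    abs_of_pos hr] at h3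
  have hr1 : r = 1 := by linarith
  rw [hr1, ofReal_one, one_mul] at e1
  have h4 : ((φ t 0 - π / 2 : ℝ) * I : ℂ) = φ t 0 * I + -(π / 2 * I) := by
    push_cast
    ring
  rw [h4, exp_add, ← e1, exp_neg, exp_pi_div_two_mul_I, inv_I]
  linear_combination (c t) * I_mul_I

end HemisphereCurve

/-! ### Central projection of an arc between contacts -/

theorem HasArg.hasDerivAt {W : ℝ → ℂ} {W' : ℂ} {ψ : ℝ → ℝ} {t : ℝ} (hψ : ContinuousAt ψ t)
    (hW : HasDerivAt W W' t) (harg : ∀ᶠ s in 𝓝 t, HasArg (W s) (ψ s)) :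
    HasDerivAt ψ (W' / W t).im t := by
  have ht : HasArg (W t) (ψ t) := harg.self_of_nhds
  have hne : W t ≠ 0 := ht.ne_zero
  have hn : 0 < normSq (W t) := normSq_pos.2 hne
  have h0 : W t * conj (W t) = (normSq (W t) : ℂ) := mul_conj _
  have h1 : HasDerivAt (fun s => W s * conj (W t)) (W' * conj (W t)) t := hW.mul_const _
  -- Multiplication by `conj (W t)` rotates the curve to the positive axis, where the principal
  -- logarithm is differentiable and its imaginary part differs from `ψ` by a constant.
  have h2 : W t * conj (W t) ∈ slitPlane := by
    rw [h0]
    exact ofReal_mem_slitPlane.2 hn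
  have h3 := (imCLM.hasFDerivAt (x := log (W t * conj (W t)))).comp_hasDerivAt t (h1.clog_real h2)
  have h4 : W' * conj (W t) / (W t * conj (W t)) = W' / W t :=
    mul_div_mul_right _ _ ((_root_.map_ne_zero _).2 hne)
  rw [h4] at h3
  have h5 : ∀ᶠ s in 𝓝 t, ψ s = Complex.arg (W s * conj (W t)) + ψ t := by
    have h6 : ∀ᶠ s in 𝓝 t, |ψ s - ψ t| < π :=
      Metric.eventually_nhds_iff_ball.2 (by
        obtain ⟨δ, hδ, hb⟩ := Metric.continuousAt_iff.1 hψ π Real.pi_pos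
        exact ⟨δ, hδ, fun y hy => by simpa [Real.dist_eq] using hb hy⟩)
    filter_upwards [harg, h6] with s hs hs'
    have h7 := hs.mul ht.star
    rw [← sub_eq_add_neg] at h7
    obtain ⟨k, hk⟩ := h7.sub_eq (HasArg.arg h7.ne_zero)
    have h8 := neg_pi_lt_arg (W s * conj (W t))
    have h9 := arg_le_pi (W s * conj (W t))
    have hpi := Real.pi_pos
    rw [abs_lt] at hs'
    have k1 : (k : ℝ) < 1 := by
      by_contra! hc
      nlinarith
    have k2 : (-1 : ℝ) < k := by
      by_contra! hc
      nlinarith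
    have k1' : k < 1 := by exact_mod_cast k1
    have k2' : -1 < k := by exact_mod_cast k2
    have k0 : k = 0 := by omega
    rw [k0] at hk
    simp at hk
    linarith
  have h10 : HasDerivAt (fun s => Complex.arg (W s * conj (W t)) + ψ t) (W' / W t).im t := by
    have := h3.add_const (ψ t)
    simpa [Function.comp_def, log_im] using this
  exact h10.congr_of_eventuallyEq h5

/-- A function vanishing at the left end of an interval and positive inside does not satisfy
the differential inequality `f' ≤ M f`. -/
theorem exists_mul_lt_deriv {f f' : ℝ → ℝ} {a b : ℝ} (hab : a < b)
    (hf : ∀ t, HasDerivAt f (f' t) t) (h0 : f a = 0) (hpos : ∀ t ∈ Ioo a b, 0 < f t) (M : ℝ) :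
    ∃ t ∈ Ioo a b, M * f t < f' t := by
  by_contra! hc
  -- If `f' ≤ M f` held, the integrating factor would make this product antitone from the value 0,
  -- against positivity.
  have h1 : ∀ t, HasDerivAt (fun t => f t * Real.exp (-M * t))
      (f' t * Real.exp (-M * t) + f t * (Real.exp (-M * t) * -M)) t := fun t => by
    refine ((hf t).mul (((hasDerivAt_id t).const_mul (-M)).exp)).congr_deriv ?_
    simp
  have h2 : AntitoneOn (fun t => f t * Real.exp (-M * t)) (Icc a b) := by
    refine antitoneOn_of_deriv_nonpos (convex_Icc a b)
      (fun t _ => (h1 t).continuousAt.continuousWithinAt)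
      (fun t _ => (h1 t).differentiableAt.differentiableWithinAt) fun t ht => ?_
    rw [interior_Icc] at ht
    rw [(h1 t).deriv]
    have := hc t ht
    have e := Real.exp_pos (-M * t)
    nlinarith
  have hm : (a + b) / 2 ∈ Ioo a b := ⟨by linarith, by linarith⟩
  have h3 := h2 (left_mem_Icc.2 hab.le) (Ioo_subset_Icc_self hm) hm.1.le
  simp only [h0, zero_mul] at h3
  exact absurd h3 (not_le.2 (mul_pos (hpos _ hm) (Real.exp_pos _)))

theorem exists_mul_lt_neg_deriv {f f' : ℝ → ℝ} {a b : ℝ} (hab : a < b)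
    (hf : ∀ t, HasDerivAt f (f' t) t) (h0 : f b = 0) (hpos : ∀ t ∈ Ioo a b, 0 < f t) (M : ℝ) :
    ∃ t ∈ Ioo a b, M * f t < -f' t := by
  obtain ⟨t, ht, h⟩ := exists_mul_lt_deriv (f := fun t => f (-t)) (f' := fun t => -f' (-t))
    (neg_lt_neg hab) (fun t => by
      have := (hf (-t)).scomp t (hasDerivAt_neg t)
      simpa [Function.comp_def] using this) (by simpa using h0)
    (fun t ht => hpos (-t) ⟨by linarith [ht.2], by linarith [ht.1]⟩) M
  exact ⟨-t, ⟨by linarith [ht.2], by linarith [ht.1]⟩, h⟩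

/-- The determinant of position, velocity and acceleration of the curve `(c, h)`. -/
def curvDet (c : ℝ → ℂ) (h : ℝ → ℝ) (t : ℝ) : ℝ :=
  h t * (conj (deriv c t) * deriv (deriv c) t).im + deriv h t * (conj (deriv (deriv c) t) * c t).im +
    deriv (deriv h) t * (conj (c t) * deriv c t).im

namespace HemisphereCurve

variable {c : ℝ → ℂ} {h : ℝ → ℝ}

/-- The direction of motion of the central projection `c / h`. -/
def projDir (c : ℝ → ℂ) (h : ℝ → ℝ) (t : ℝ) : ℂ := h t * deriv c t - deriv h t * c t

theorem hasDerivAt_projDir (H : HemisphereCurve c h) (t : ℝ) :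
    HasDerivAt (projDir c h) (h t * deriv (deriv c) t - deriv (deriv h) t * c t) t := by
  have h1 := ((H.hasDerivAt_h t).ofReal_comp.mul (H.hasDerivAt_deriv_c t)).sub
    ((H.hasDerivAt_deriv_h t).ofReal_comp.mul (H.hasDerivAt_c t))
  refine h1.congr_deriv ?_
  ring

theorem projDir_mul_conj_re (H : HemisphereCurve c h) (t : ℝ) :
    (projDir c h t * conj (deriv c t)).re =
      h t * ((deriv c t).re ^ 2 + (deriv c t).im ^ 2 + deriv h t ^ 2) := by
  simp [projDir]
  linear_combination (-deriv h t) * H.orthogonal t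

/-- Off the boundary circle the directions of motion of `c` and `c / h` make an angle less than π/2,
so the principal argument in `projArg` is continuous. -/
theorem projDir_mul_conj_re_pos (H : HemisphereCurve c h) {t : ℝ} (ht : 0 < h t) :
    0 < (projDir c h t * conj (deriv c t)).re := by
  rw [H.projDir_mul_conj_re]
  have h1 : 0 < normSq (deriv c t) := normSq_pos.2 (H.deriv_c_ne_zero t)
  rw [normSq_apply] at h1
  have : 0 < (deriv c t).re ^ 2 + (deriv c t).im ^ 2 + deriv h t ^ 2 := by
    nlinarith [sq_nonneg (deriv h t)]
  positivity

/-- The argument of `projDir` obtained from an argument `Θ` of the velocity of `c`. -/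
def projArg (c : ℝ → ℂ) (h : ℝ → ℝ) (Θ : ℝ → ℝ) (t : ℝ) : ℝ :=
  Θ t + arg (projDir c h t * conj (deriv c t))

variable {Θ : ℝ → ℝ}

theorem hasArg_projArg (H : HemisphereCurve c h) (hΘ : ∀ t, HasArg (deriv c t) (Θ t)) {t : ℝ}
    (ht : 0 < h t) : HasArg (projDir c h t) (projArg c h Θ t) := by
  have h1 : projDir c h t * conj (deriv c t) ≠ 0 := fun e => by
    have := H.projDir_mul_conj_re_pos ht
    rw [e] at this
    simp at this
  have h2 := (hΘ t).mul (HasArg.arg h1)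
  have h3 : deriv c t * (projDir c h t * conj (deriv c t)) =
      (normSq (deriv c t) : ℂ) * projDir c h t := by
    rw [← mul_conj]
    ring
  rw [h3] at h2
  exact h2.of_real_mul (normSq_pos.2 (H.deriv_c_ne_zero t))

theorem continuousAt_projArg (H : HemisphereCurve c h) (hΘc : Continuous Θ) {t : ℝ}
    (ht : 0 < h t) : ContinuousAt (projArg c h Θ) t := by
  refine hΘc.continuousAt.add ?_
  have h1 : ContinuousAt (fun t => projDir c h t * conj (deriv c t)) t :=
    (H.hasDerivAt_projDir t).continuousAt.mul
      (continuous_conj.continuousAt.comp (H.hasDerivAt_deriv_c t).continuousAt)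
  exact ContinuousAt.comp (f := fun t => projDir c h t * conj (deriv c t))
    (continuousAt_arg (Or.inl (H.projDir_mul_conj_re_pos ht))) h1

/-- In the derivative of `projDir` the terms `h' c'` cancel, and what remains pairs with `projDir`
to `h` times the determinant. Thus the projected curve turns left exactly where `curvDet` is
positive. -/
theorem hasDerivAt_projArg (H : HemisphereCurve c h) (hΘc : Continuous Θ)
    (hΘ : ∀ t, HasArg (deriv c t) (Θ t)) {t : ℝ} (ht : 0 < h t) :
    HasDerivAt (projArg c h Θ) (h t * curvDet c h t / normSq (projDir c h t)) t := by
  have h1 : ∀ᶠ s in 𝓝 t, 0 < h s :=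
    H.contDiff_h.continuous.continuousAt.eventually (lt_mem_nhds ht)
  have h2 := HasArg.hasDerivAt (H.continuousAt_projArg hΘc ht) (H.hasDerivAt_projDir t)
    (h1.mono fun s hs => H.hasArg_projArg hΘ hs)
  refine h2.congr_deriv ?_
  rw [div_im, div_sub_div_same]
  congr 1
  simp [projDir, curvDet]
  ring

theorem monotoneOn_projArg (H : HemisphereCurve c h) (hΘc : Continuous Θ)
    (hΘ : ∀ t, HasArg (deriv c t) (Θ t)) {a b : ℝ} (hpos : ∀ t ∈ Ioo a b, 0 < h t)
    (hK : ∀ t ∈ Ioo a b, 0 ≤ curvDet c h t) : MonotoneOn (projArg c h Θ) (Ioo a b) := by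
  refine monotoneOn_of_deriv_nonneg (convex_Ioo a b)
    (fun t ht => (H.continuousAt_projArg hΘc (hpos t ht)).continuousWithinAt) ?_ ?_
  · rw [interior_Ioo]
    exact fun t ht =>
      (H.hasDerivAt_projArg hΘc hΘ (hpos t ht)).differentiableAt.differentiableWithinAt
  · rw [interior_Ioo]
    intro t ht
    rw [(H.hasDerivAt_projArg hΘc hΘ (hpos t ht)).deriv]
    exact div_nonneg (mul_nonneg (hpos t ht).le (hK t ht)) (normSq_nonneg _)

/-- Near a point of contact, the projected curve moves along its asymptote wherever the height
changes fast. -/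
theorem eventually_projArg_near (H : HemisphereCurve c h) (hΘc : Continuous Θ) {t : ℝ}
    (ht : East c h t) {σ : ℝ} (hσ : σ = 1 ∨ σ = -1) {ε : ℝ} (hε : 0 < ε) :
    ∃ δ > 0, ∃ M : ℝ, ∀ s, |s - t| < δ → 0 < h s → M * h s < σ * deriv h s →
      |projArg c h Θ s - (Θ t + σ * (π / 2))| < ε := by
  obtain ⟨-, μ, hμ, e⟩ := id ht
  have hn := H.normSq_eq_one ht.1
  -- This is `projDir * conj c'` divided by `σ h'`, with the quotient `h / (σ h')` made an
  -- independent variable. It is continuous at quotient 0, where only the position term is left.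
  set F : ℝ × ℝ → ℂ := fun x =>
    x.1 * (normSq (deriv c x.2) : ℂ) - σ * (c x.2 * conj (deriv c x.2)) with hF
  have hFt : F (0, t) = (μ : ℂ) * (σ * I) := by
    have h3 : c t * conj (c t) = 1 := by
      rw [mul_conj, normSq_apply, ← sq, ← sq, hn, ofReal_one]
    simp only [hF, e, map_mul, conj_ofReal, conj_I, ofReal_zero, zero_mul, zero_sub]
    linear_combination (σ * μ * I) * h3
  have hFc : Continuous F := by
    have h1 := H.contDiff_c.continuous
    have h2 := H.contDiff_deriv_c.continuous
    have h3 : Continuous fun x : ℝ × ℝ => normSq (deriv c x.2) :=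
      continuous_normSq.comp (h2.comp continuous_snd)
    fun_prop
  have harg : arg (F (0, t)) = σ * (π / 2) := by
    rw [hFt, arg_real_mul _ hμ]
    rcases hσ with rfl | rfl
    · simp
    · simp
  have hslit : F (0, t) ∈ slitPlane := by
    rw [hFt]
    right
    rcases hσ with rfl | rfl <;> simp [hμ.ne']
  have hg : ContinuousAt (fun x : ℝ × ℝ => Θ x.2 + arg (F x)) (0, t) :=
    (hΘc.comp continuous_snd).continuousAt.add ((continuousAt_arg hslit).comp hFc.continuousAt)
  obtain ⟨δ, hδ, hb⟩ := Metric.continuousAt_iff.1 hg ε hε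
  -- With M = 1/δ the hypothesis says that the quotient `h / (σ h')` is less than `δ`.
  refine ⟨δ, hδ, δ⁻¹, fun s hs hpos hM => ?_⟩
  have h1 : 0 < σ * deriv h s := (by positivity : 0 < δ⁻¹ * h s).trans hM
  have h2 : h s / (σ * deriv h s) < δ := by
    rw [div_lt_iff₀ h1]
    rw [inv_mul_lt_iff₀ hδ] at hM
    exact hM
  have h3 := hb (x := (h s / (σ * deriv h s), s)) (by
    rw [Prod.dist_eq, max_lt_iff, Real.dist_eq, Real.dist_eq, sub_zero,
      abs_of_pos (div_pos hpos h1)]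
    exact ⟨h2, hs⟩)
  rw [Real.dist_eq] at h3
  have h4 : projDir c h s * conj (deriv c s) =
      (σ * deriv h s : ℝ) * F (h s / (σ * deriv h s), s) := by
    have h5 : (σ : ℂ) * deriv h s ≠ 0 := by
      rw [← ofReal_mul]
      exact ofReal_ne_zero.2 h1.ne'
    have h6 : (σ : ℂ) * σ = 1 := by rcases hσ with rfl | rfl <;> simp
    simp only [hF, projDir, ← mul_conj]
    push_cast
    rw [mul_sub, ← mul_assoc, mul_div_cancel₀ _ h5]
    linear_combination (((deriv h s : ℝ) : ℂ) * c s * conj (deriv c s)) * h6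
  rw [projArg, h4, arg_real_mul _ h1]
  simpa [harg] using h3

/-- A locally convex arc of the curve between two consecutive points of contact, whose tangent
turns by at most a half turn, is a geodesic. -/
theorem curvDet_eq_zero_of_nonneg (H : HemisphereCurve c h) (hΘc : Continuous Θ)
    (hΘ : ∀ t, HasArg (deriv c t) (Θ t)) {a b : ℝ} (ha : East c h a) (hb : East c h b)
    (hpos : ∀ t ∈ Ioo a b, 0 < h t) (hK : ∀ t ∈ Ioo a b, 0 ≤ curvDet c h t)
    (hturn : Θ b - Θ a ≤ π) : ∀ t ∈ Ioo a b, curvDet c h t = 0 := by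
  have hmono := H.monotoneOn_projArg hΘc hΘ hpos hK
  have hlow : ∀ x ∈ Ioo a b, Θ a + π / 2 ≤ projArg c h Θ x := by
    intro x hx
    refine le_of_forall_pos_lt_add fun ε hε => ?_
    obtain ⟨δ, hδ, M, hM⟩ := H.eventually_projArg_near hΘc ha (Or.inl rfl) hε
    have hm : a < min x (a + δ) := lt_min hx.1 (by linarith)
    have hsub : ∀ s ∈ Ioo a (min x (a + δ)), s ∈ Ioo a b := fun s hs =>
      ⟨hs.1, (hs.2.trans_le (min_le_left _ _)).trans hx.2⟩
    -- Points with `h' > M h` exist arbitrarily close to `a`; there `projArg` is near its asymptotic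
    -- value, and monotonicity carries the bound on to `x`.
    obtain ⟨s, hs, hs'⟩ := exists_mul_lt_deriv hm H.hasDerivAt_h ha.1
      (fun s hs => hpos s (hsub s hs)) M
    have h1 := hM s (by
      rw [abs_of_pos (by linarith [hs.1])]
      linarith [hs.2.trans_le (min_le_right _ _)]) (hpos s (hsub s hs)) (by rwa [one_mul])
    have h2 := hmono (hsub s hs) hx (hs.2.trans_le (min_le_left _ _)).le
    rw [abs_lt] at h1
    linarith [h1.1]
  have hupp : ∀ x ∈ Ioo a b, projArg c h Θ x ≤ Θ b - π / 2 := by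
    intro x hx
    refine le_of_forall_pos_lt_add fun ε hε => ?_
    obtain ⟨δ, hδ, M, hM⟩ := H.eventually_projArg_near hΘc hb (Or.inr rfl) hε
    have hm : max x (b - δ) < b := max_lt hx.2 (by linarith)
    have hsub : ∀ s ∈ Ioo (max x (b - δ)) b, s ∈ Ioo a b := fun s hs =>
      ⟨hx.1.trans ((le_max_left _ _).trans_lt hs.1), hs.2⟩
    obtain ⟨s, hs, hs'⟩ := exists_mul_lt_neg_deriv hm H.hasDerivAt_h hb.1
      (fun s hs => hpos s (hsub s hs)) M
    have h1 := hM s (by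
      rw [abs_of_neg (by linarith [hs.2])]
      linarith [(le_max_right _ _).trans_lt hs.1]) (hpos s (hsub s hs)) (by linarith)
    have h2 := hmono hx (hsub s hs) ((le_max_left _ _).trans_lt hs.1).le
    rw [abs_lt] at h1
    linarith [h1.2]
  -- The bound on the turn makes the upper asymptotic angle at most the lower one, so the direction
  -- is constant.
  have hconst : ∀ x ∈ Ioo a b, projArg c h Θ x = Θ a + π / 2 := fun x hx =>
    le_antisymm (by linarith [hupp x hx]) (hlow x hx)
  intro t ht
  have h1 := H.hasDerivAt_projArg hΘc hΘ (hpos t ht)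
  have h2 : HasDerivAt (projArg c h Θ) 0 t :=
    (hasDerivAt_const t (Θ a + π / 2)).congr_of_eventuallyEq
      (eventually_of_mem (Ioo_mem_nhds ht.1 ht.2) hconst)
  have h3 := h1.unique h2
  have h4 : normSq (projDir c h t) ≠ 0 :=
    (normSq_pos.2 (H.hasArg_projArg hΘ (hpos t ht)).ne_zero).ne'
  rw [div_eq_zero_iff, or_iff_left h4, mul_eq_zero, or_iff_right (hpos t ht).ne'] at h3
  exact h3

end HemisphereCurve

/-! ### Alternating signs of the curvature -/

/-- `f` takes values of opposite signs at consecutive points of a sequence running once around the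
circle in `m` steps. -/
def Alternates (f : ℝ → ℝ) (m : ℕ) : Prop :=
  ∃ z : ℕ → ℝ, StrictMono z ∧ z m = z 0 + 2 * π ∧ ∀ j < m, f (z j) * f (z (j + 1)) < 0

namespace HemisphereCurve

variable {c : ℝ → ℂ} {h : ℝ → ℝ}

theorem periodic_curvDet (H : HemisphereCurve c h) : Function.Periodic (curvDet c h) (2 * π) := by
  have hd : ∀ {E : Type} [NormedAddCommGroup E] [NormedSpace ℝ E] {f : ℝ → E},
      Function.Periodic f (2 * π) → Function.Periodic (deriv f) (2 * π) := fun hf s => by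
    rw [← deriv_comp_add_const]
    congr 1
    exact funext hf
  intro s
  simp only [curvDet, H.periodic_c s, H.periodic_h s, hd H.periodic_c s, hd H.periodic_h s,
    hd (hd H.periodic_c) s, hd (hd H.periodic_h) s]

theorem curvDet_eq_zero {a b : ℝ} (hz : ∀ t ∈ Ioo a b, h t = 0) :
    ∀ t ∈ Ioo a b, curvDet c h t = 0 := by
  intro t ht
  have h0 : ∀ᶠ s in 𝓝 t, h s = 0 := eventually_of_mem (Ioo_mem_nhds ht.1 ht.2) hz
  have h1 : deriv h =ᶠ[𝓝 t] fun _ => 0 := by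
    have : h =ᶠ[𝓝 t] fun _ => 0 := h0
    simpa using this.deriv
  have h2 := h1.deriv_eq
  rw [curvDet, hz t ht, h1.self_of_nhds, h2]
  simp

/-- With nonpositive curvature after the contact, the curve would stay on or below the great circle
to which it is tangent. In the upper hemisphere it would then run along this circle, a geodesic. -/
theorem exists_curvDet_pos (H : HemisphereCurve c h)
    (hgeo : ∀ a b, a < b → ∃ s ∈ Ioo a b, curvDet c h s ≠ 0) {t : ℝ} (ht : East c h t) {b : ℝ}
    (hb : t < b) : ∃ s ∈ Ioo t b, 0 < curvDet c h s := by
  by_contra! hK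
  obtain ⟨h0, μ, hμ, e⟩ := ht
  have hn := H.normSq_eq_one h0
  set p := c t with hp
  have hw : ∀ s, HasDerivAt (fun s => conj p * c s) (conj p * deriv c s) s :=
    fun s => (H.hasDerivAt_c s).const_mul _
  have hw' : ∀ s, HasDerivAt (fun s => conj p * deriv c s) (conj p * deriv (deriv c) s) s :=
    fun s => (H.hasDerivAt_deriv_c s).const_mul _
  have hr : ∀ s, HasDerivAt (fun s => (conj p * c s).re) (conj p * deriv c s).re s :=
    fun s => hasDerivAt_re_comp (hw s)
  have hm : ∀ s, HasDerivAt (fun s => (conj p * c s).im) (conj p * deriv c s).im s :=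
    fun s => hasDerivAt_im_comp (hw s)
  have hr' : ∀ s, HasDerivAt (fun s => (conj p * deriv c s).re) (conj p * deriv (deriv c) s).re s :=
    fun s => hasDerivAt_re_comp (hw' s)
  have hm' : ∀ s, HasDerivAt (fun s => (conj p * deriv c s).im) (conj p * deriv (deriv c) s).im s :=
    fun s => hasDerivAt_im_comp (hw' s)
  -- Project centrally to the tangent plane at `p`, with X = Im(p̄c)/Re(p̄c) and Y = h/Re(p̄c). Then
  -- `A` and `B` are Y' and X' times Re(p̄c)², and `A / B` is the slope dY/dX, whose derivative has
  -- the sign of `curvDet` near `t`.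
  set A : ℝ → ℝ := fun s =>
    deriv h s * (conj p * c s).re - h s * (conj p * deriv c s).re with hA
  set B : ℝ → ℝ := fun s => (conj p * deriv c s).im * (conj p * c s).re -
    (conj p * c s).im * (conj p * deriv c s).re with hB
  have hAd : ∀ s, HasDerivAt A (deriv (deriv h) s * (conj p * c s).re -
      h s * (conj p * deriv (deriv c) s).re) s := fun s => by
    refine (((H.hasDerivAt_deriv_h s).mul (hr s)).sub
      ((H.hasDerivAt_h s).mul (hr' s))).congr_deriv ?_
    ring
  have hBd : ∀ s, HasDerivAt B ((conj p * deriv (deriv c) s).im * (conj p * c s).re -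
      (conj p * c s).im * (conj p * deriv (deriv c) s).re) s := fun s => by
    refine (((hm' s).mul (hr s)).sub ((hm s).mul (hr' s))).congr_deriv ?_
    ring
  have hrt : (conj p * c t).re = 1 := by
    rw [← hp, mul_comm, mul_conj, ofReal_re, normSq_apply]
    linarith
  have hBt : 0 < B t := by
    have h1 : conj p * c t = 1 := by
      rw [← hp, mul_comm, mul_conj, normSq_apply, ← sq, ← sq, hn, ofReal_one]
    have h2 : conj p * deriv c t = μ * I := by
      rw [e]
      linear_combination (μ * I : ℂ) * h1
    simp only [hB, h1, h2]
    simpa using hμ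
  have hev : ∀ᶠ s in 𝓝 t, 0 < (conj p * c s).re ∧ 0 < B s :=
    ((hr t).continuousAt.eventually (lt_mem_nhds (show 0 < (conj p * c t).re by rw [hrt]; exact one_pos))).and
      ((hBd t).continuousAt.eventually (lt_mem_nhds hBt))
  obtain ⟨δ, hδ, hball⟩ := Metric.eventually_nhds_iff_ball.1 hev
  set d := min b (t + δ) with hd
  have htd : t < d := lt_min hb (by linarith)
  have hpos : ∀ s ∈ Ico t d, 0 < (conj p * c s).re ∧ 0 < B s := fun s hs => hball s (by
    have := hs.2.trans_le (min_le_right b (t + δ))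
    rw [Metric.mem_ball, Real.dist_eq, abs_of_nonneg (by linarith [hs.1])]
    linarith)
  have hint : interior (Ico t d) = Ioo t d := interior_Ico
  have hAB : ∀ s ∈ Ico t d, A s ≤ 0 := by
    have hder : ∀ s ∈ Ico t d, HasDerivAt (fun s => A s / B s)
        ((conj p * c s).re * curvDet c h s / B s ^ 2) s := fun s hs => by
      refine ((hAd s).div (hBd s) (hpos s hs).2.ne').congr_deriv ?_
      congr 1
      simp [hA, hB, curvDet]
      linear_combination (p.re * (c s).re + p.im * (c s).im) * (h s *
        ((deriv c s).re * (deriv (deriv c) s).im - (deriv c s).im * (deriv (deriv c) s).re) +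
        deriv h s * ((deriv (deriv c) s).re * (c s).im - (deriv (deriv c) s).im * (c s).re) +
        deriv (deriv h) s * ((c s).re * (deriv c s).im - (c s).im * (deriv c s).re)) * hn
    have hanti : AntitoneOn (fun s => A s / B s) (Ico t d) := by
      refine antitoneOn_of_deriv_nonpos (convex_Ico t d)
        (fun s hs => (hder s hs).continuousAt.continuousWithinAt) ?_ ?_ <;> rw [hint]
      · exact fun s hs =>
          (hder s (Ioo_subset_Ico_self hs)).differentiableAt.differentiableWithinAt
      · intro s hs
        rw [(hder s (Ioo_subset_Ico_self hs)).deriv]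
        exact div_nonpos_of_nonpos_of_nonneg (mul_nonpos_of_nonneg_of_nonpos
          (hpos s (Ioo_subset_Ico_self hs)).1.le
          (hK s ⟨hs.1, hs.2.trans_le (min_le_left _ _)⟩)) (sq_nonneg _)
    intro s hs
    have h1 := hanti (left_mem_Ico.2 htd) hs hs.1
    have h2 : A t = 0 := by simp only [hA, h0, H.deriv_h_eq_zero h0]; ring
    simp only [h2, zero_div] at h1
    by_contra! hc
    exact absurd h1 (not_le.2 (div_pos hc (hpos s hs).2))
  have hzero : ∀ s ∈ Ico t d, h s = 0 := by
    have hder : ∀ s ∈ Ico t d, HasDerivAt (fun s => h s / (conj p * c s).re)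
        (A s / (conj p * c s).re ^ 2) s := fun s hs =>
      (H.hasDerivAt_h s).div (hr s) (hpos s hs).1.ne'
    have hanti : AntitoneOn (fun s => h s / (conj p * c s).re) (Ico t d) := by
      refine antitoneOn_of_deriv_nonpos (convex_Ico t d)
        (fun s hs => (hder s hs).continuousAt.continuousWithinAt) ?_ ?_ <;> rw [hint]
      · exact fun s hs =>
          (hder s (Ioo_subset_Ico_self hs)).differentiableAt.differentiableWithinAt
      · intro s hs
        rw [(hder s (Ioo_subset_Ico_self hs)).deriv]
        exact div_nonpos_of_nonpos_of_nonneg (hAB s (Ioo_subset_Ico_self hs)) (sq_nonneg _)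
    intro s hs
    have h1 := hanti (left_mem_Ico.2 htd) hs hs.1
    simp only [h0, zero_div] at h1
    refine le_antisymm ?_ (H.nonneg s)
    by_contra! hc
    exact absurd h1 (not_le.2 (div_pos hc (hpos s hs).1))
  obtain ⟨s, hs, hs'⟩ := hgeo t d htd
  exact hs' (curvDet_eq_zero (fun s hs => hzero s (Ioo_subset_Ico_self hs)) s hs)

variable {φ : ℝ → ℝ → ℝ}

theorem tangentArg_le (H : HemisphereCurve c h) (hφ : IsSecantArg c φ) {s t : ℝ}
    (hs : East c h s) (ht : East c h t) (hst : s ≤ t) (hts : t ≤ s + 2 * π) :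
    φ s 0 ≤ φ t 0 := by
  rcases hst.eq_or_lt with rfl | hst
  · exact le_rfl
  rcases hts.eq_or_lt with rfl | hts
  · rw [H.tangentArg_add_two_pi hφ hs]
    linarith [Real.pi_pos]
  · exact (H.tangentArg_lt hφ hs ht hst hts).le

theorem exists_curvDet_neg (H : HemisphereCurve c h)
    (hgeo : ∀ a b, a < b → ∃ s ∈ Ioo a b, curvDet c h s ≠ 0) (hφ : IsSecantArg c φ) {a b : ℝ}
    (ha : East c h a) (hb : East c h b) (hab : a < b) (hba : b ≤ a + 2 * π)
    (hturn : φ b 0 - φ a 0 ≤ π) : ∃ s ∈ Ioo a b, curvDet c h s < 0 := by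
  by_contra! hK
  obtain ⟨x, hx, hx0⟩ : ∃ x ∈ Ioo a b, h x ≠ 0 := by
    by_contra! hz
    obtain ⟨s, hs, hs'⟩ := hgeo a b hab
    exact hs' (curvDet_eq_zero hz s hs)
  have hcl : IsClosed {s | h s = 0} := isClosed_eq H.contDiff_h.continuous continuous_const
  -- There may be further contacts between `a` and `b`; the last one before `x` and the first one
  -- after it bound an arc of positive height, whose tangent turns no more than that of the whole.
  obtain ⟨a', ⟨ha'1, ha'2⟩, ha'3⟩ := (isCompact_Icc.inter_right hcl).exists_isGreatest
    (⟨a, left_mem_Icc.2 hx.1.le, ha.1⟩ : (Icc a x ∩ {s | h s = 0}).Nonempty)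
  obtain ⟨b', ⟨hb'1, hb'2⟩, hb'3⟩ := (isCompact_Icc.inter_right hcl).exists_isLeast
    (⟨b, right_mem_Icc.2 hx.2.le, hb.1⟩ : (Icc x b ∩ {s | h s = 0}).Nonempty)
  have hax : a' < x := lt_of_le_of_ne ha'1.2 fun e => hx0 (e ▸ ha'2)
  have hxb : x < b' := lt_of_le_of_ne hb'1.1 fun e => hx0 (e ▸ hb'2)
  have hpos : ∀ s ∈ Ioo a' b', 0 < h s := by
    intro s hs
    refine lt_of_le_of_ne (H.nonneg s) fun e => ?_
    rcases le_total s x with hsx | hsx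
    · exact absurd (ha'3 ⟨⟨ha'1.1.trans hs.1.le, hsx⟩, e.symm⟩) (not_le.2 hs.1)
    · exact absurd (hb'3 ⟨⟨hsx, hs.2.le.trans hb'1.2⟩, e.symm⟩) (not_le.2 hs.2)
  have ea := H.east_of_east ha ha'2
  have eb := H.east_of_east ha hb'2
  have h1 := H.tangentArg_le hφ ha ea ha'1.1 (by linarith [hx.2])
  have h2 := H.tangentArg_le hφ eb hb hb'1.2 (by linarith [hx.1])
  obtain ⟨s, hs, hs'⟩ := hgeo a' b' (hax.trans hxb)
  exact hs' (H.curvDet_eq_zero_of_nonneg (Θ := fun s => φ s 0)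
    (hφ.cont.comp (by fun_prop : Continuous fun s : ℝ => (s, (0 : ℝ)))) hφ.tangent ea eb hpos
    (fun s hs => hK s ⟨ha'1.1.trans_lt hs.1, hs.2.trans_le hb'1.2⟩) (by linarith) s hs)

/-- If the points of contact are not contained in an open semicircle, then the tangent turns by at
most a half turn between consecutive ones. -/
theorem turn_le_pi (H : HemisphereCurve c h) (hφ : IsSecantArg c φ) {n : ℕ} {t : ℕ → ℝ}
    (htm : StrictMono t) (htn : t n = t 0 + 2 * π) (hE : ∀ i ≤ n, East c h (t i))
    (hsemi : ∀ v : ℂ, ‖v‖ = 1 → ∃ i < n, (conj v * c (t i)).re ≤ 0) {i : ℕ} (hi : i < n) :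
    φ (t (i + 1)) 0 - φ (t i) 0 ≤ π := by
  by_contra! hgap
  have hpi := Real.pi_pos
  have hmono : ∀ j k, j ≤ k → k ≤ n → φ (t j) 0 ≤ φ (t k) 0 := fun j k hjk hk =>
    H.tangentArg_le hφ (hE j (hjk.trans hk)) (hE k hk) (htm.monotone hjk) (by
      have h1 := htm.monotone hk
      have h2 := htm.monotone (Nat.zero_le j)
      linarith)
  have hn : φ (t n) 0 = φ (t 0) 0 + 2 * π := by
    rw [htn, H.tangentArg_add_two_pi hφ (hE 0 (Nat.zero_le n))]
  -- The midpoint of the arc complementary to the gap. That arc is shorter than a half turn, so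
  -- every contact lies within less than π/2 of its midpoint.
  obtain ⟨j, hj, hle⟩ := hsemi
    (exp (((φ (t i) 0 + φ (t (i + 1)) 0 + 2 * π) / 2 - π / 2 : ℝ) * I))
    (norm_exp_ofReal_mul_I _)
  have hcos : (conj (exp (((φ (t i) 0 + φ (t (i + 1)) 0 + 2 * π) / 2 - π / 2 : ℝ) * I)) *
      c (t j)).re = Real.cos (φ (t j) 0 - (φ (t i) 0 + φ (t (i + 1)) 0 + 2 * π) / 2) := by
    rw [H.contact_eq hφ (hE j hj.le), ← exp_conj, ← exp_add, map_mul, conj_ofReal, conj_I,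
      ← exp_ofReal_mul_I_re]
    congr 2
    push_cast
    ring
  rw [hcos] at hle
  rcases Nat.lt_or_ge i j with hij | hij
  · have h1 := hmono (i + 1) j hij hj.le
    have h2 := hmono j n hj.le le_rfl
    have h3 := hmono 0 i (Nat.zero_le i) hi.le
    exact absurd hle (not_le.2 (Real.cos_pos_of_mem_Ioo ⟨by linarith, by linarith⟩))
  · have h1 := hmono j i hij hi.le
    have h2 := hmono 0 j (Nat.zero_le j) hj.le
    have h3 := hmono (i + 1) n hi le_rfl
    rw [← Real.cos_add_two_pi] at hle
    exact absurd hle (not_le.2 (Real.cos_pos_of_mem_Ioo ⟨by linarith, by linarith⟩))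

theorem alternates_of_east (H : HemisphereCurve c h)
    (hgeo : ∀ a b, a < b → ∃ s ∈ Ioo a b, curvDet c h s ≠ 0) {n : ℕ} {t : ℕ → ℝ}
    (hn0 : 0 < n) (htm : StrictMono t) (htn : t n = t 0 + 2 * π) (hE : ∀ i ≤ n, East c h (t i))
    (hsemi : ∀ v : ℂ, ‖v‖ = 1 → ∃ i < n, (conj v * c (t i)).re ≤ 0) :
    Alternates (curvDet c h) (2 * n) := by
  obtain ⟨φ, hφ⟩ := H.exists_isSecantArg
  have hy : ∀ i, ∃ y ∈ Ioo (t i) (t (i + 1)), i < n → curvDet c h y < 0 := by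
    intro i
    by_cases hi : i < n
    · obtain ⟨y, hy, hy'⟩ := H.exists_curvDet_neg hgeo hφ (hE i hi.le) (hE (i + 1) hi)
        (htm (Nat.lt_succ_self i)) (by
          have h1 := htm.monotone (show i + 1 ≤ n from hi)
          have h2 := htm.monotone (Nat.zero_le i)
          linarith) (H.turn_le_pi hφ htm htn hE hsemi hi)
      exact ⟨y, hy, fun _ => hy'⟩
    · obtain ⟨y, hy⟩ := nonempty_Ioo.2 (htm (Nat.lt_succ_self i))
      exact ⟨y, hy, fun h => absurd h hi⟩
  choose y hyt hyK using hy
  -- The negative points, closed up after one turn at index `n`; the values beyond `n` only keep the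
  -- sequence strictly increasing.
  set Y : ℕ → ℝ := fun i => if i < n then y i else y 0 + 2 * π + (i - n : ℕ) with hY
  have hYn : Y n = y 0 + 2 * π := by simp [hY]
  have hY0 : Y 0 = y 0 := by simp [hY, hn0]
  have hYt : ∀ i < n, Y i < t (i + 1) ∧ t (i + 1) < Y (i + 1) := by
    intro i hi
    refine ⟨by simp only [hY, hi, if_true]; exact (hyt i).2, ?_⟩
    rcases (show i + 1 ≤ n from hi).eq_or_lt with e | h1
    · rw [e, hYn, htn]
      linarith [(hyt 0).1]
    · simp only [hY, h1, if_true]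
      exact (hyt _).1
  have hYlt : ∀ i, Y i < Y (i + 1) := by
    intro i
    by_cases hi : i < n
    · exact (hYt i hi).1.trans (hYt i hi).2
    · have h1 : ¬ i + 1 < n := by omega
      have h2 : i + 1 - n = i - n + 1 := by omega
      simp only [hY, hi, h1, if_false, h2]
      push_cast
      linarith
  have hYK : ∀ i ≤ n, curvDet c h (Y i) < 0 := by
    intro i hi
    rcases hi.eq_or_lt with rfl | hi
    · rw [hYn, H.periodic_curvDet]
      exact hyK 0 hn0
    · simp only [hY, hi, if_true]
      exact hyK i hi
  have hx : ∀ i, ∃ x ∈ Ioo (Y i) (Y (i + 1)), i < n → 0 < curvDet c h x := by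
    intro i
    by_cases hi : i < n
    · obtain ⟨x, hx, hx'⟩ := H.exists_curvDet_pos hgeo (hE (i + 1) hi) (hYt i hi).2
      exact ⟨x, ⟨(hYt i hi).1.trans hx.1, hx.2⟩, fun _ => hx'⟩
    · obtain ⟨x, hx⟩ := nonempty_Ioo.2 (hYlt i)
      exact ⟨x, hx, fun h => absurd h hi⟩
  choose x hxY hxK using hx
  refine ⟨fun j => if j % 2 = 0 then Y (j / 2) else x (j / 2), strictMono_nat_of_lt_succ ?_, ?_, ?_⟩
  · intro j
    rcases Nat.even_or_odd' j with ⟨k, rfl | rfl⟩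
    · have e1 : (2 * k) % 2 = 0 := by omega
      have e2 : (2 * k + 1) % 2 ≠ 0 := by omega
      have e3 : (2 * k + 1) / 2 = k := by omega
      have e4 : (2 * k) / 2 = k := by omega
      simp only [e1, e2, e3, e4, if_true, if_false]
      exact (hxY k).1
    · have e1 : (2 * k + 1 + 1) % 2 = 0 := by omega
      have e2 : (2 * k + 1) % 2 ≠ 0 := by omega
      have e3 : (2 * k + 1) / 2 = k := by omega
      have e4 : (2 * k + 1 + 1) / 2 = k + 1 := by omega
      simp only [e1, e2, e3, e4, if_true, if_false]
      exact (hxY k).2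
  · have e1 : (2 * n) % 2 = 0 := by omega
    have e4 : (2 * n) / 2 = n := by omega
    simp only [e1, e4, if_true, Nat.zero_mod, Nat.zero_div, hYn, hY0]
  · intro j hj
    rcases Nat.even_or_odd' j with ⟨k, rfl | rfl⟩
    · have e1 : (2 * k) % 2 = 0 := by omega
      have e2 : (2 * k + 1) % 2 ≠ 0 := by omega
      have e3 : (2 * k + 1) / 2 = k := by omega
      have e4 : (2 * k) / 2 = k := by omega
      simp only [e1, e2, e3, e4, if_true, if_false]
      exact mul_neg_of_neg_of_pos (hYK k (by omega)) (hxK k (by omega))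
    · have e1 : (2 * k + 1 + 1) % 2 = 0 := by omega
      have e2 : (2 * k + 1) % 2 ≠ 0 := by omega
      have e3 : (2 * k + 1) / 2 = k := by omega
      have e4 : (2 * k + 1 + 1) / 2 = k + 1 := by omega
      simp only [e1, e2, e3, e4, if_true, if_false]
      exact mul_neg_of_pos_of_neg (hxK k (by omega)) (hYK (k + 1) (by omega))

theorem curvDet_conj (H : HemisphereCurve c h) :
    curvDet (fun t => conj (c t)) h = fun t => -curvDet c h t := by
  have h2 : deriv (fun t => conj (deriv c t)) = fun t => conj (deriv (deriv c) t) :=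
    funext fun t => (hasDerivAt_conj_comp (H.hasDerivAt_deriv_c t)).deriv
  funext t
  simp only [curvDet, H.deriv_conj, h2]
  simp
  ring

/-- The sign changes of the curvature of a curve in a hemisphere, in terms of points of contact with
the boundary which are not contained in an open semicircle. -/
theorem alternates (H : HemisphereCurve c h)
    (hgeo : ∀ a b, a < b → ∃ s ∈ Ioo a b, curvDet c h s ≠ 0) {n : ℕ} {t : ℕ → ℝ}
    (hn0 : 0 < n) (htm : StrictMono t) (htn : t n = t 0 + 2 * π) (hE : ∀ i ≤ n, h (t i) = 0)
    (hsemi : ∀ v : ℂ, ‖v‖ = 1 → ∃ i < n, (conj v * c (t i)).re ≤ 0) :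
    Alternates (curvDet c h) (2 * n) := by
  rcases H.eq_or_of_contact (hE 0 (Nat.zero_le n)) with h0 | h0
  · exact H.alternates_of_east hgeo hn0 htm htn (fun i hi => H.east_of_east h0 (hE i hi)) hsemi
  · have hK := H.curvDet_conj
    obtain ⟨z, h1, h2, h3⟩ := H.conjugate.alternates_of_east (by simpa [hK] using hgeo) hn0 htm htn
      (fun i hi => H.conjugate.east_of_east h0 (hE i hi)) (fun v hv => by
        obtain ⟨i, hi, hle⟩ := hsemi (conj v) (by simpa using hv)
        exact ⟨i, hi, by simpa using hle⟩)
    exact ⟨z, h1, h2, by simpa [hK] using h3⟩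

end HemisphereCurve

/-! ### Sign changes and genuine inflections on the circle -/

theorem coe_add_two_pi (t : ℝ) : ((t + 2 * π : ℝ) : S1) = t := by
  rw [AddCircle.coe_add, AddCircle.coe_period, add_zero]

theorem injOn_coe {a b : ℝ} (hab : b < a + 2 * π) : InjOn (fun t : ℝ => (t : S1)) (Icc a b) :=
  have : Fact (0 < 2 * π) := ⟨Real.two_pi_pos⟩
  fun _ hx _ hy e => (AddCircle.coe_eq_coe_iff_of_mem_Ico (a := a)
    ⟨hx.1, hx.2.trans_lt hab⟩ ⟨hy.1, hy.2.trans_lt hab⟩).1 e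

theorem sign_eq_neg_sign {a b : ℝ} (hab : a * b < 0) : SignType.sign a = -SignType.sign b := by
  rcases mul_neg_iff.1 hab with ⟨h1, h2⟩ | ⟨h1, h2⟩
  · rw [sign_pos h1, sign_neg h2, neg_neg]
  · rw [sign_neg h1, sign_pos h2]

theorem Alternates.changesSign {f : S1 → ℝ} {m : ℕ} (hf : Alternates (fun t => f t) m) :
    ChangesSign f m := by
  obtain ⟨z, hz, hm, hs⟩ := hf
  refine ⟨fun i => z i, fun i j hij => hz hij, fun i j => ?_, fun i => ?_⟩
  · have h1 := hz j.2
    have h2 := hz.monotone (Nat.zero_le i)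
    linarith
  · refine ⟨fun h0 => ?_, ?_⟩
    · have := hs i i.2
      simp only [h0, zero_mul, lt_irrefl] at this
    · obtain ⟨k, rfl⟩ : ∃ k, m = k + 1 := ⟨m - 1, by have := i.2; omega⟩
      refine (sign_eq_neg_sign (hs i i.2)).trans ?_
      suffices hfr : f (z ((i : ℕ) + 1) : S1) = f (z (finRotate (k + 1) i : ℕ) : S1) from
        congrArg (fun y => -SignType.sign y) hfr
      rcases Nat.lt_or_ge i k with hik | hik
      · have : i = ⟨(i : ℕ), by omega⟩ := rfl
        rw [this, finRotate_of_lt hik]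
      · have hi : (i : ℕ) = k := by have := i.2; omega
        have : i = Fin.last k := Fin.ext hi
        -- The last index rotates to 0, and `z m` and `z 0` represent the same point of the circle.
        rw [this, finRotate_last, Fin.val_last, hm, coe_add_two_pi, Fin.val_zero]

/-- A continuous function with finitely many zeros which takes values of opposite signs at the ends
of an interval changes sign at an isolated zero. -/
theorem exists_isolated_sign_change {g : ℝ → ℝ} (hg : Continuous g) {a b : ℝ} (hab : a < b)
    (hs : g a * g b < 0) (hfin : (Icc a b ∩ {t | g t = 0}).Finite) :
    ∃ x ∈ Ioo a b, g x = 0 ∧ ∃ p q, x ∈ Ioo p q ∧ (∀ y ∈ Ioo p q, g y = 0 → y = x) ∧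
      (∃ y ∈ Ioo p q, 0 < g y) ∧ ∃ y ∈ Ioo p q, g y < 0 := by
  wlog ha : g a < 0 generalizing g
  · have ha' : 0 < g a := (mul_neg_iff.1 hs).elim (fun h => h.1) fun h => absurd h.1 ha
    obtain ⟨x, hx, h0, p, q, h1, h2, h3, h4⟩ := this (g := fun t => -g t) hg.neg (by linarith)
      (by simpa using hfin) (by linarith)
    exact ⟨x, hx, by linarith, p, q, h1, fun y hy h => h2 y hy (by linarith),
      by simpa using h4, by simpa using h3⟩
  have hb : 0 < g b := (mul_neg_iff.1 hs).elim (fun h => absurd h.1 ha.not_gt) fun h => h.2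
  -- The last point that is a limit of negative values: to its right the function is nonnegative,
  -- and positive near it since the zeros are isolated.
  set S : Set ℝ := Icc a b ∩ {t | g t < 0} with hS
  have haS : a ∈ S := ⟨left_mem_Icc.2 hab.le, ha⟩
  have hbdd : BddAbove S := ⟨b, fun t ht => ht.1.2⟩
  set x := sSup S with hxdef
  have hlub : IsLUB S x := isLUB_csSup ⟨a, haS⟩ hbdd
  have hxb : x ≤ b := hlub.2 fun t ht => ht.1.2
  have hax : a ≤ x := hlub.1 haS
  have hle : g x ≤ 0 := by
    have h1 : x ∈ closure S := hlub.mem_closure ⟨a, haS⟩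
    have h2 : closure S ⊆ {t | g t ≤ 0} :=
      closure_minimal (fun t ht => show g t ≤ 0 from le_of_lt ht.2) (isClosed_le hg continuous_const)
    exact h2 h1
  have hxb' : x < b := lt_of_le_of_ne hxb fun e => absurd hle (by rw [e]; exact not_le.2 hb)
  have hright : ∀ y, x < y → y ≤ b → 0 ≤ g y := fun y hy hyb => by
    by_contra! hc
    exact absurd (hlub.1 (show y ∈ S from ⟨⟨hax.trans hy.le, hyb⟩, hc⟩)) (not_le.2 hy)
  have h0 : g x = 0 := by
    refine le_antisymm hle ?_
    have h1 : x ∈ closure (Ioc x b) := by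
      rw [closure_Ioc hxb'.ne]
      exact left_mem_Icc.2 hxb
    have h2 : closure (Ioc x b) ⊆ {t | 0 ≤ g t} :=
      closure_minimal (fun t ht => hright t ht.1 ht.2) (isClosed_le continuous_const hg)
    exact h2 h1
  have hax' : a < x := lt_of_le_of_ne hax fun e => absurd h0 (by rw [← e]; exact ha.ne)
  have hnhds : ((Icc a b ∩ {t | g t = 0}) \ {x})ᶜ ∩ Ioo a b ∈ 𝓝 x :=
    inter_mem ((hfin.subset sdiff_subset).isClosed.isOpen_compl.mem_nhds (by simp))
      (Ioo_mem_nhds hax' hxb')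
  obtain ⟨p, q, hpq, hsub⟩ := mem_nhds_iff_exists_Ioo_subset.1 hnhds
  have hiso : ∀ y ∈ Ioo p q, g y = 0 → y = x := fun y hy hy0 => by
    by_contra hne
    exact (hsub hy).1 ⟨⟨Ioo_subset_Icc_self (hsub hy).2, hy0⟩, hne⟩
  refine ⟨x, ⟨hax', hxb'⟩, h0, p, q, hpq, hiso, ?_, ?_⟩
  · obtain ⟨y, hy⟩ := nonempty_Ioo.2 hpq.2
    have hy' : y ∈ Ioo p q := ⟨hpq.1.trans hy.1, hy.2⟩
    exact ⟨y, hy', lt_of_le_of_ne (hright y hy.1 (hsub hy').2.2.le)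
      fun e => hy.1.ne' (hiso y hy' e.symm)⟩
  · obtain ⟨s, hs, hps, hsx⟩ := hlub.exists_between hpq.1
    exact ⟨s, ⟨hps, hsx.trans_lt hpq.2⟩, hs.2⟩

theorem Alternates.le_ncard {f : S1 → ℝ} {m : ℕ} (hm2 : 2 ≤ m)
    (hf : Alternates (fun t => f t) m) (hc : Continuous fun t : ℝ => f t)
    (hfin : {x | f x = 0}.Finite) :
    m ≤ {x | f x = 0 ∧ ∃ U : Set S1, IsOpen U ∧ IsConnected U ∧ x ∈ U ∧
      (∀ y ∈ U, f y = 0 → y = x) ∧ (∃ y ∈ U, 0 < f y) ∧ ∃ y ∈ U, f y < 0}.ncard := by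
  obtain ⟨z, hz, hm, hs⟩ := hf
  have hx : ∀ j : Fin m, ∃ x ∈ Ioo (z j) (z (j + 1)), f x = 0 ∧ ∃ p q, x ∈ Ioo p q ∧
      (∀ y ∈ Ioo p q, f (y : S1) = 0 → y = x) ∧
      (∃ y ∈ Ioo p q, 0 < f (y : S1)) ∧ ∃ y ∈ Ioo p q, f (y : S1) < 0 := by
    intro j
    refine exists_isolated_sign_change hc (hz (Nat.lt_succ_self j)) (hs j j.2) ?_
    -- For `j = 0` this needs `m ≥ 2`. An arc shorter than one turn embeds in the circle, so it
    -- contains finitely many zeros.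
    have h1 : z (j + 1) < z j + 2 * π := by
      rcases Nat.eq_zero_or_pos (j : ℕ) with h0 | h0
      · rw [h0, ← hm]
        exact hz (by omega)
      · have h2 := hz.monotone (show (j : ℕ) + 1 ≤ m from j.2)
        have h3 := hz h0
        linarith
    refine Finite.of_finite_image (f := fun t : ℝ => (t : S1)) (hfin.subset ?_)
      ((injOn_coe h1).mono inter_subset_left)
    rintro _ ⟨t, ht, rfl⟩
    exact ht.2
  choose x hxz h0 p q hpq hiso hp hn using hx
  have hinj : Function.Injective fun j => (x j : S1) := by
    have hmono : StrictMono x := fun i j hij =>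
      (hxz i).2.trans_le ((hz.monotone (show (i : ℕ) + 1 ≤ j from hij)).trans (hxz j).1.le)
    have hrange : ∀ j, x j ∈ Icc (z 0) (x ⟨m - 1, by omega⟩) := fun j =>
      ⟨(hz.monotone (Nat.zero_le j)).trans (hxz j).1.le,
        hmono.monotone (Fin.le_def.2 (by have := j.2; simp only; omega))⟩
    have hlt : x ⟨m - 1, by omega⟩ < z 0 + 2 * π := by
      have := (hxz ⟨m - 1, by omega⟩).2
      simp only [show m - 1 + 1 = m by omega] at this
      linarith
    exact fun i j e => hmono.injective (injOn_coe hlt (hrange i) (hrange j) e)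
  have hcard : (range fun j => (x j : S1)).ncard = m := by
    rw [← image_univ, ncard_image_of_injective _ hinj, ncard_univ, Nat.card_fin]
  conv_lhs => rw [← hcard]
  refine ncard_le_ncard ?_ (hfin.subset fun y hy => hy.1)
  rintro _ ⟨j, rfl⟩
  refine ⟨h0 j, (fun t : ℝ => (t : S1)) '' Ioo (p j) (q j),
    QuotientAddGroup.isOpenMap_coe _ isOpen_Ioo,
    (isConnected_Ioo ((hpq j).1.trans (hpq j).2)).image _
      (AddCircle.continuous_mk' _).continuousOn, mem_image_of_mem _ (hpq j), ?_, ?_, ?_⟩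
  · rintro _ ⟨y, hy, rfl⟩ hy0
    exact congrArg (fun t : ℝ => (t : S1)) (hiso j y hy hy0)
  · obtain ⟨y, hy, hy'⟩ := hp j
    exact ⟨y, mem_image_of_mem _ hy, hy'⟩
  · obtain ⟨y, hy, hy'⟩ := hn j
    exact ⟨y, mem_image_of_mem _ hy, hy'⟩

/-! ### From the spherical curve to coordinates -/

theorem circleDeriv_coe (δ : S1 → E3) (t : ℝ) :
    circleDeriv δ t = deriv (fun s : ℝ => δ s) t := by
  have h1 := deriv_comp_const_add (f := fun s : ℝ => δ s) t 0
  rw [add_zero] at h1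
  rw [← h1, circleDeriv]
  simp only [AddCircle.coe_add]

theorem inner_eq (x y : E3) : inner ℝ x y = x 0 * y 0 + x 1 * y 1 + x 2 * y 2 := by
  simp [PiLp.inner_apply, Fin.sum_univ_three]
  ring

theorem inner_cross (x y z : E3) : inner ℝ z (cross x y) =
    z 0 * (x 1 * y 2 - x 2 * y 1) + z 1 * (x 2 * y 0 - x 0 * y 2) +
      z 2 * (x 0 * y 1 - x 1 * y 0) := by
  rw [inner_eq]
  simp [cross, cross_apply]

theorem exists_orthogonal_unit (u : E3) : ∃ a : E3, inner ℝ a a = (1 : ℝ) ∧ inner ℝ u a = (0 : ℝ) := by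
  obtain ⟨v, hv, hv0⟩ : ∃ v : E3, inner ℝ u v = (0 : ℝ) ∧ v ≠ 0 := by
    by_cases h : u 0 = 0
    · refine ⟨!₂[1, 0, 0], by rw [inner_eq]; simp [h], fun e => ?_⟩
      have := congrArg (fun w : E3 => w 0) e
      simp at this
    · refine ⟨!₂[u 1, -u 0, 0], by rw [inner_eq]; simp; ring, fun e => ?_⟩
      have := congrArg (fun w : E3 => w 1) e
      simp at this
      exact h this
  have hn := norm_ne_zero_iff.2 hv0
  refine ⟨‖v‖⁻¹ • v, ?_, ?_⟩
  · rw [real_inner_smul_left, real_inner_smul_right, real_inner_self_eq_norm_sq]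
    field_simp
  · rw [real_inner_smul_right, hv, mul_zero]

/-- A unit vector is the last one of a positive orthonormal frame. -/
theorem exists_frame {u : E3} (hu : u ∈ S2) : ∃ a b : E3,
    inner ℝ a a = (1 : ℝ) ∧ inner ℝ b b = (1 : ℝ) ∧ inner ℝ a b = (0 : ℝ) ∧
    inner ℝ u a = (0 : ℝ) ∧ inner ℝ u b = (0 : ℝ) ∧
    (∀ w : E3, inner ℝ a w ^ 2 + inner ℝ b w ^ 2 + inner ℝ u w ^ 2 = ‖w‖ ^ 2) ∧
    ∀ x y z : E3, inner ℝ z (cross x y) =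
      inner ℝ u x * (inner ℝ a y * inner ℝ b z - inner ℝ b y * inner ℝ a z) +
      inner ℝ u y * (inner ℝ a z * inner ℝ b x - inner ℝ b z * inner ℝ a x) +
      inner ℝ u z * (inner ℝ a x * inner ℝ b y - inner ℝ b x * inner ℝ a y) := by
  have huu : inner ℝ u u = (1 : ℝ) := by
    rw [real_inner_self_eq_norm_sq, mem_sphere_zero_iff_norm.1 hu, one_pow]
  obtain ⟨a, haa, hua⟩ := exists_orthogonal_unit u
  set b := cross u a with hb
  have b0 : b 0 = u 1 * a 2 - u 2 * a 1 := by simp [hb, cross, cross_apply]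
  have b1 : b 1 = u 2 * a 0 - u 0 * a 2 := by simp [hb, cross, cross_apply]
  have b2 : b 2 = u 0 * a 1 - u 1 * a 0 := by simp [hb, cross, cross_apply]
  have hbb : inner ℝ b b = (1 : ℝ) := by
    rw [inner_eq] at huu haa hua ⊢
    rw [b0, b1, b2]
    linear_combination huu * (a 0 * a 0 + a 1 * a 1 + a 2 * a 2) + haa -
      (u 0 * a 0 + u 1 * a 1 + u 2 * a 2) * hua
  have hab : inner ℝ a b = (0 : ℝ) := by
    rw [inner_eq, b0, b1, b2]
    ring
  have hub : inner ℝ u b = (0 : ℝ) := by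
    rw [inner_eq, b0, b1, b2]
    ring
  refine ⟨a, b, haa, hbb, hab, hua, hub, fun w => ?_, fun x y z => ?_⟩
  · set M : Matrix (Fin 3) (Fin 3) ℝ := !![a 0, a 1, a 2; b 0, b 1, b 2; u 0, u 1, u 2] with hM
    have h1 : M * M.transpose = 1 := by
      rw [inner_eq] at huu haa hua hbb hab hub
      ext i j
      fin_cases i <;> fin_cases j <;> simp [hM, Matrix.mul_apply, Fin.sum_univ_three] <;> linarith
    have h2 := mul_eq_one_comm.1 h1
    have h3 : ∀ i j, M 0 i * M 0 j + M 1 i * M 1 j + M 2 i * M 2 j =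
        (1 : Matrix (Fin 3) (Fin 3) ℝ) i j := fun i j => by
      rw [← h2]
      simp [Matrix.mul_apply, Fin.sum_univ_three]
    have h00 := h3 0 0
    have h01 := h3 0 1
    have h02 := h3 0 2
    have h11 := h3 1 1
    have h12 := h3 1 2
    have h22 := h3 2 2
    simp [hM] at h00 h01 h02 h11 h12 h22
    rw [← real_inner_self_eq_norm_sq, inner_eq, inner_eq, inner_eq, inner_eq]
    linear_combination w 0 ^ 2 * h00 + w 1 ^ 2 * h11 + w 2 ^ 2 * h22 +
      2 * w 0 * w 1 * h01 + 2 * w 0 * w 2 * h02 + 2 * w 1 * w 2 * h12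
  -- Since `b = u × a`, the determinant of the frame is `⟨b, b⟩ = 1`; the formula is then
  -- multiplicativity of determinants.
  · have hdet : a 0 * (b 1 * u 2 - b 2 * u 1) + a 1 * (b 2 * u 0 - b 0 * u 2) +
        a 2 * (b 0 * u 1 - b 1 * u 0) = 1 := by
      rw [inner_eq] at hbb
      rw [b0, b1, b2] at hbb ⊢
      linear_combination hbb
    rw [inner_cross]
    simp only [inner_eq]
    linear_combination -(z 0 * (x 1 * y 2 - x 2 * y 1) + z 1 * (x 2 * y 0 - x 0 * y 2) +
      z 2 * (x 0 * y 1 - x 1 * y 0)) * hdet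

/-- The orthogonal projection along the normal of the plane spanned by `a` and `b`, read as a complex
number. -/
def planeProj (a b : E3) : E3 →L[ℝ] ℂ :=
  ofRealCLM.comp (innerSL ℝ a) + I • ofRealCLM.comp (innerSL ℝ b)

theorem planeProj_re (a b w : E3) : (planeProj a b w).re = inner ℝ a w := by
  simp [planeProj]

theorem planeProj_im (a b w : E3) : (planeProj a b w).im = inner ℝ b w := by
  simp [planeProj]

theorem deriv_clm_comp {F : Type*} [NormedAddCommGroup F] [NormedSpace ℝ F] (L : E3 →L[ℝ] F)
    {g : ℝ → E3} (hg : Differentiable ℝ g) :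
    deriv (fun t => L (g t)) = fun t => L (deriv g t) :=
  funext fun t => (L.hasFDerivAt.comp_hasDerivAt t (hg t).hasDerivAt).deriv

section Conversion

variable {γ : S1 → E3}

theorem IsC2RegularSimpleClosed.contDiff_deriv (hγ : IsC2RegularSimpleClosed γ) :
    ContDiff ℝ 1 (deriv fun t : ℝ => γ t) :=
  (contDiff_succ_iff_deriv.1 hγ.contDiff).2.2

theorem IsC2RegularSimpleClosed.deriv_ne_zero (hγ : IsC2RegularSimpleClosed γ) (t : ℝ) :
    deriv (fun t : ℝ => γ t) t ≠ 0 := by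
  rw [← circleDeriv_coe]
  exact hγ.regular t

variable {a b u : E3}

theorem curvDet_eq (hγ : IsC2RegularSimpleClosed γ)
    (hdet : ∀ x y z : E3, inner ℝ z (cross x y) =
      inner ℝ u x * (inner ℝ a y * inner ℝ b z - inner ℝ b y * inner ℝ a z) +
      inner ℝ u y * (inner ℝ a z * inner ℝ b x - inner ℝ b z * inner ℝ a x) +
      inner ℝ u z * (inner ℝ a x * inner ℝ b y - inner ℝ b x * inner ℝ a y)) (t : ℝ) :
    geodesicCurvature γ t =
      curvDet (fun t => planeProj a b (γ t)) (fun t => innerSL ℝ u (γ t)) t /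
        ‖deriv (fun t : ℝ => γ t) t‖ ^ 3 := by
  have h1 : Differentiable ℝ fun t : ℝ => γ t := hγ.contDiff.differentiable two_ne_zero
  have h2 := hγ.contDiff_deriv.differentiable one_ne_zero
  have h3 : (fun s : ℝ => circleDeriv γ s) = deriv fun s : ℝ => γ s := funext (circleDeriv_coe γ)
  rw [geodesicCurvature, circleDeriv_coe (circleDeriv γ), h3, circleDeriv_coe γ, hdet]
  congr 1
  simp only [curvDet, deriv_clm_comp _ h1, deriv_clm_comp _ h2]
  simp only [innerSL_apply_apply, mul_im, conj_re,
    conj_im, planeProj_re, planeProj_im]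
  ring

/-- Injectivity survives the projection because two points of the hemisphere with equal projections
have equal heights. -/
theorem hemisphereCurve (hγ : IsC2RegularSimpleClosed γ) (hhemi : range γ ⊆ hemisphere u)
    (hnorm : ∀ w : E3, inner ℝ a w ^ 2 + inner ℝ b w ^ 2 + inner ℝ u w ^ 2 = ‖w‖ ^ 2) :
    HemisphereCurve (fun t => planeProj a b (γ t)) (fun t => innerSL ℝ u (γ t)) := by
  have h1 : Differentiable ℝ fun t : ℝ => γ t := hγ.contDiff.differentiable two_ne_zero
  have hzero : ∀ w : E3, planeProj a b w = 0 → inner ℝ u w = (0 : ℝ) → w = 0 := by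
    intro w h2 h3
    have h4 := hnorm w
    rw [← planeProj_re a b, ← planeProj_im a b, h2, h3] at h4
    simpa using h4.symm
  have hsphere : ∀ t : ℝ, (planeProj a b (γ t)).re ^ 2 + (planeProj a b (γ t)).im ^ 2 +
      (innerSL ℝ u (γ t)) ^ 2 = 1 := fun t => by
    rw [planeProj_re, planeProj_im, innerSL_apply_apply, hnorm,
      mem_sphere_zero_iff_norm.1 (hγ.mem_sphere t), one_pow]
  have hnonneg : ∀ t : ℝ, 0 ≤ innerSL ℝ u (γ t) := fun t => (hhemi (mem_range_self _)).2
  refine ⟨(planeProj a b).contDiff.comp hγ.contDiff, (innerSL ℝ u).contDiff.comp hγ.contDiff,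
    fun t => by rw [coe_add_two_pi], fun t => by rw [coe_add_two_pi], hsphere, hnonneg, ?_, ?_⟩
  · intro t h2 h3
    rw [deriv_clm_comp _ h1] at h2 h3
    exact hγ.deriv_ne_zero t (hzero _ h2 h3)
  · intro s r h0 hr e
    have h2 := hsphere s
    have h3 := hsphere (s + r)
    rw [e] at h3
    have h4 : innerSL ℝ u (γ (s + r : ℝ)) = innerSL ℝ u (γ s) := by
      rw [← sq_eq_sq₀ (hnonneg _) (hnonneg _)]
      linarith
    have h5 : γ (s + r : ℝ) - γ s = 0 := by
      refine hzero _ (by rw [map_sub, e, sub_self]) ?_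
      rw [← innerSL_apply_apply ℝ, map_sub, h4, sub_self]
    have h6 := injOn_coe (a := s) (b := s + r) (by linarith) (right_mem_Icc.2 (by linarith))
      (left_mem_Icc.2 (by linarith)) (hγ.simple (sub_eq_zero.1 h5))
    linarith

end Conversion

/-! ### Cyclic order of the contacts and conclusion -/

/-- The elements of a finite set of angles, listed increasingly and continued after one turn. -/
theorem exists_cyclic_enumeration {Q : Finset ℝ} {n : ℕ} (hn : 0 < n) (hQ : Q.card = n)
    (h0 : ∀ x ∈ Q, x ∈ Ico 0 (2 * π)) :
    ∃ t : ℕ → ℝ, StrictMono t ∧ t n = t 0 + 2 * π ∧ (∀ i < n, t i ∈ Q) ∧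
      ∀ x ∈ Q, ∃ i < n, t i = x := by
  set e := Q.orderEmbOfFin hQ with he
  have hmem : ∀ i, e i ∈ Q := fun i => Finset.orderEmbOfFin_mem Q hQ i
  refine ⟨fun i => if h : i < n then e ⟨i, h⟩ else e ⟨0, hn⟩ + 2 * π + (i - n : ℕ),
    strictMono_nat_of_lt_succ fun i => ?_, ?_, fun i hi => ?_, fun x hx => ?_⟩
  · rcases lt_trichotomy (i + 1) n with h | h | h
    · simp only [h, (Nat.lt_succ_self i).trans h, dif_pos]
      exact e.strictMono (Fin.mk_lt_mk.2 (Nat.lt_succ_self i))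
    · have h1 : i < n := by omega
      have h2 : ¬ i + 1 < n := by omega
      simp only [h1, h2, dif_pos, dif_neg, not_false_eq_true]
      have h3 := (h0 _ (hmem ⟨i, h1⟩)).2
      have h4 := (h0 _ (hmem ⟨0, hn⟩)).1
      have h5 : (0 : ℝ) ≤ (i + 1 - n : ℕ) := Nat.cast_nonneg _
      linarith
    · have h1 : ¬ i < n := by omega
      have h2 : ¬ i + 1 < n := by omega
      have h3 : i + 1 - n = i - n + 1 := by omega
      simp only [h1, h2, dif_neg, not_false_eq_true, h3]
      push_cast
      linarith
  · simp [hn]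
  · simp only [hi, dif_pos]
    exact hmem _
  · have h1 : x ∈ range e := by
      rw [he, Finset.range_orderEmbOfFin]
      exact hx
    obtain ⟨i, rfl⟩ := h1
    exact ⟨i, i.2, by simp⟩

theorem alternates_geodesicCurvature {γ : S1 → E3} (hγ : IsC2RegularSimpleClosed γ) {u : E3}
    (hu : u ∈ S2) (hhemi : range γ ⊆ hemisphere u) (hgeo : ¬ HasGeodesicSubarc γ) {P : Finset E3}
    (hP : (P : Set E3) ⊆ range γ ∩ greatCircle u)
    (hsemi : ∀ v ∈ greatCircle u, ¬ (P : Set E3) ⊆ openSemicircle (greatCircle u) v) :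
    Alternates (fun t : ℝ => geodesicCurvature γ t) (2 * P.card) ∧
      Continuous fun t : ℝ => geodesicCurvature γ t := by
  obtain ⟨a, b, haa, hbb, hab, hua, hub, hnorm, hdet⟩ := exists_frame hu
  have H := hemisphereCurve hγ hhemi hnorm
  have hk := curvDet_eq hγ hdet
  set c := fun t : ℝ => planeProj a b (γ t) with hc
  set h := fun t : ℝ => innerSL ℝ u (γ t) with hh
  have hpos : ∀ t : ℝ, 0 < ‖deriv (fun t : ℝ => γ t) t‖ ^ 3 := fun t =>
    pow_pos (norm_pos_iff.2 (hγ.deriv_ne_zero t)) 3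
  have hKc : Continuous (curvDet c h) := by
    have c0 := H.contDiff_c.continuous
    have h0 := H.contDiff_h.continuous
    have c1 := H.contDiff_deriv_c.continuous
    have h1 := H.contDiff_deriv_h.continuous
    have c2 := H.contDiff_deriv_c.continuous_deriv le_rfl
    have h2 := H.contDiff_deriv_h.continuous_deriv le_rfl
    unfold curvDet
    fun_prop
  have hkc : Continuous fun t : ℝ => geodesicCurvature γ t := by
    simp only [hk]
    exact hKc.div (hγ.contDiff_deriv.continuous.norm.pow 3) fun t => (hpos t).ne'
  refine ⟨?_, hkc⟩
  have hgeo' : ∀ x y, x < y → ∃ s ∈ Ioo x y, curvDet c h s ≠ 0 := by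
    intro x y hxy
    by_contra! hz
    -- The middle third is a closed subarc inside the open interval.
    refine hgeo ⟨(2 * x + y) / 3, (x + 2 * y) / 3, by linarith, fun t ht => ?_⟩
    rw [hk, hz t ⟨by linarith [ht.1], by linarith [ht.2]⟩, zero_div]
  have hvec : ∀ v : ℂ, ‖v‖ = 1 → v.re • a + v.im • b ∈ greatCircle u := by
    intro v hv
    constructor
    · have h1 : ‖v.re • a + v.im • b‖ ^ 2 = 1 := by
        rw [← real_inner_self_eq_norm_sq]
        simp only [inner_add_left, inner_add_right, real_inner_smul_left, real_inner_smul_right,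
          haa, hbb, hab, real_inner_comm a b]
        have := normSq_eq_norm_sq v
        rw [hv, normSq_apply] at this
        linarith
      exact mem_sphere_zero_iff_norm.2
        ((sq_eq_sq₀ (norm_nonneg _) zero_le_one).1 (by rw [h1, one_pow]))
    · rw [inner_add_right, real_inner_smul_right, real_inner_smul_right, hua, hub]
      ring
  have hτ : ∀ p ∈ P, ∃ t ∈ Ico 0 (2 * π), γ (t : S1) = p := by
    intro p hp
    obtain ⟨x, rfl⟩ := (hP hp).1
    have : Fact (0 < 2 * π) := ⟨Real.two_pi_pos⟩
    obtain ⟨t, ht, rfl⟩ := (AddCircle.coe_image_Ico_eq (2 * π) 0).symm ▸ mem_univ x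
    exact ⟨t, by simpa using ht, rfl⟩
  choose! τ hτ1 hτ2 using hτ
  have hinj : InjOn τ P := fun p hp q hq e => by rw [← hτ2 p hp, ← hτ2 q hq, e]
  -- The empty set is contained in every open semicircle, so `hsemi` excludes it.
  have hn : 0 < P.card := by
    rw [Finset.card_pos, Finset.nonempty_iff_ne_empty]
    rintro rfl
    exact hsemi _ (hvec 1 (by simp)) (by simp)
  classical
  obtain ⟨t, htm, htn, htQ, hQt⟩ := exists_cyclic_enumeration (Q := P.image τ) hn
    (Finset.card_image_of_injOn hinj) (by
      intro x hx
      obtain ⟨p, hp, rfl⟩ := Finset.mem_image.1 hx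
      exact hτ1 p hp)
  have hcontact : ∀ i < P.card, h (t i) = 0 := by
    intro i hi
    obtain ⟨p, hp, e⟩ := Finset.mem_image.1 (htQ i hi)
    simp only [hh]
    rw [← e, hτ2 p hp, innerSL_apply_apply]
    exact (hP hp).2.2
  obtain ⟨z, hz1, hz2, hz3⟩ := H.alternates hgeo' hn htm htn (fun i hi => by
    rcases hi.eq_or_lt with rfl | hi
    · rw [htn, H.periodic_h]
      exact hcontact 0 hn
    · exact hcontact i hi) (fun v hv => by
    have h1 := hsemi _ (hvec v hv)
    rw [not_subset] at h1
    obtain ⟨p, hp, hp'⟩ := h1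
    obtain ⟨i, hi, e⟩ := hQt (τ p) (Finset.mem_image_of_mem τ hp)
    refine ⟨i, hi, ?_⟩
    by_contra! hlt
    refine hp' ⟨(hP hp).2, ?_⟩
    have h2 : (conj v * c (t i)).re = inner ℝ (v.re • a + v.im • b) p := by
      simp only [hc, e, hτ2 p hp, mul_re, conj_re, conj_im, planeProj_re, planeProj_im,
        inner_add_left, real_inner_smul_left]
      ring
    rwa [← h2])
  refine ⟨z, hz1, hz2, fun j hj => ?_⟩
  simp only [hk]
  rw [div_mul_div_comm]
  exact div_neg_of_neg_of_pos (hz3 j hj) (mul_pos (hpos _) (hpos _))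

end SphericalCurve

end

theorem theorem3p2 (γ : SphericalCurve.S1 → SphericalCurve.E3)
    (hγ : SphericalCurve.IsC2RegularSimpleClosed γ)
    (C : Set SphericalCurve.E3)
    (hC : SphericalCurve.IsCircumscribedIn (Set.range γ) C)
    (hgeo : ¬ SphericalCurve.HasGeodesicSubarc γ)
    (n : ℕ) (P : Finset SphericalCurve.E3) (hcard : P.card = n)
    (hP : (P : Set SphericalCurve.E3) ⊆ Set.range γ ∩ C)
    (hsemi : ∀ v ∈ C, ¬ (P : Set SphericalCurve.E3) ⊆ SphericalCurve.openSemicircle C v) :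
    SphericalCurve.ChangesSign (SphericalCurve.geodesicCurvature γ) (2 * n) ∧
      ((SphericalCurve.inflections γ).Finite →
        2 * n ≤ (SphericalCurve.genuineInflections γ).ncard) := by
  obtain ⟨u, hu, rfl, hhemi⟩ := hC
  subst hcard
  obtain ⟨h1, h2⟩ := SphericalCurve.alternates_geodesicCurvature hγ hu hhemi hgeo hP hsemi
  refine ⟨h1.changesSign, fun hfin => ?_⟩
  rcases Nat.eq_zero_or_pos P.card with h0 | h0
  · simp [h0]
  · exact h1.le_ncard (by omega) h2 hfin
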